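/- **Setting.** Let $\tau,m,M,\sigma>0$, let $\alpha\in\mathbb R\setminus\{0\}$ and $\beta\in\mathbb R$, and let $a\in H^1(0,1)$ (identified with its continuous representative on $[0,1]$) satisfy $a(x)\ge a_0$ for all $x\in[0,1]$, for some constant $a_0>0$. Consider the closed-loop overhead crane system, with $u(x,t)=y_t(0,t-x\tau)$, $$ \begin{cases} y_{tt}-(ay_x)_x+\sigma y_t=0, & 0<x<1,\ t>0,\\ \tau u_t+u_x=0, & 0<x<1,\ t>0,\\ m\,y_{tt}(0,t)-(ay_x)(0,t)=\alpha u(1,t)-\beta u(0,t), & t>0,\\ M\,y_{tt}(1,t)+(ay_x)(1,t)=0, & t>0,\\ y(x,0)=y_0(x),\quad y_t(x,0)=y_1(x),\quad u(x,0)=f(-\tau x), & 0<x<1, \end{cases} $$ written as $\Phi_t=\mathcal A\Phi$, $\Phi(0)=\Phi_0$, for $\Phi=(y,z,u,\xi,\eta)$ with $z=y_t$, $\xi=y_t(0,\cdot)$, $\eta=y_t(1,\cdot)$, in the space $\mathcal H=H^1(0,1)\times L^2(0,1)\times L^2(0,1)\times\mathbb R^2$, where $$\mathcal D(\mathcal A)=\{(y,z,u,\xi,\eta)\in\mathcal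 H:\ y\in H^2(0,1),\ z,u\in H^1(0,1),\ \xi=u(0)=z(0),\ \eta=z(1)\},$$ $$\mathcal A(y,z,u,\xi,\eta)=\Big(z,\ (ay_x)_x-\sigma z,\ -\tfrac{u_x}{\tau},\ \tfrac1m\big[(ay_x)(0)-\beta\xi+\alpha u(1)\big],\ -\tfrac{(ay_x)(1)}{M}\Big).$$ A mild solution with initial datum $\Phi_0\in\mathcal H$ is a function $\Phi\in C([0,\infty);\mathcal H)$ with $\Phi(0)=\Phi_0$ such that, for every $t\ge0$, $\int_0^t\Phi(s)\,ds\in\mathcal D(\mathcal A)$ and $\Phi(t)=\Phi_0+\mathcal A\int_0^t\Phi(s)\,ds$. For $K>0$ and $\varpi>0$ put $$\langle\Phi,\tilde\Phi\rangle_{\mathcal H}=\int_0^1(ay_x\tilde y_x+z\tilde z)\,dx+K\tau\int_0^1u\tilde u\,dx+m\xi\tilde\xi+M\eta\tilde\eta+\varpi\,\ell(\Phi)\,\ell(\tilde\Phi),$$ $$\ell(\Phi)=\int_0^1(\sigma y+z+\alpha\tau u)\,dx+m\xi+M\eta+(\beta-\alpha)y(0).$$ **Theorem.** Assume $|\alpha|<\beta$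 and $|\alpha|<K<2\beta-|\alpha|$ (for $\alpha>0$ this reads $\alpha<\beta$ and $|\alpha|<K<2\beta-\alpha$). Then for any initial data $\Phi_0=(y_0,y_1,f(-\tau\,\cdot),\xi_0,\eta_0)\in\mathcal H$, every mild solution $\Phi$ of the closed-loop system with $\Phi(0)=\Phi_0$ converges in $\mathcal H$ to $(\zeta,0,0,0,0)$ as $t\to+\infty$, both in the usual norm of $\mathcal H$ and in the norm induced by $\langle\cdot,\cdot\rangle_{\mathcal H}$ for every $\varpi>0$, where $$\zeta=\frac{1}{\sigma+\beta-\alpha}\left[\int_0^1\big(\sigma y_0(x)+y_1(x)+\alpha\tau f(-\tau x)\big)\,dx+(\beta-\alpha)y_0(0)+m\xi_0+M\eta_0\right].$$ -/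

import Mathlib

open MeasureTheory Set Filter Topology
open scoped ContDiff

namespace Crane

noncomputable section

/-- Lebesgue measure on the interval `(0,1)`. -/
abbrev mu : Measure ℝ := volume.restrict (Ioo (0 : ℝ) 1)

/-- The real Hilbert space `L²(0,1)`. -/
abbrev L2 : Type := Lp ℝ 2 mu

/-- `φ` is a test function on `(0,1)`, that is `φ ∈ C_c^∞(0,1)`. -/
def IsTest (φ : ℝ → ℝ) : Prop :=
  ContDiff ℝ ∞ φ ∧ HasCompactSupport φ ∧ tsupport φ ⊆ Ioo (0 : ℝ) 1

/-- `g` is the weak derivative of `f` on `(0,1)` (for `f`, `g` in `L²(0,1)`). -/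
def IsWeakDeriv (f g : ℝ → ℝ) : Prop :=
  ∀ φ : ℝ → ℝ, IsTest φ →
    ∫ x in Ioo (0 : ℝ) 1, f x * deriv φ x = -∫ x in Ioo (0 : ℝ) 1, g x * φ x

/-- The function `f` belongs to the Sobolev space `H¹(0,1)`. -/
def MemH1 (f : ℝ → ℝ) : Prop :=
  MemLp f 2 mu ∧ ∃ g : ℝ → ℝ, MemLp g 2 mu ∧ IsWeakDeriv f g

open Classical in
/-- The continuous representative on `[0,1]` of a function on `(0,1)`; it is uniquely determined
on `[0,1]` when it exists, as it does for functions in `H¹(0,1)` (otherwise the value is `0`).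
Point values such as `u(0)`, `u(1)` are values of this representative. -/
def contRep (f : ℝ → ℝ) : ℝ → ℝ :=
  if h : ∃ F : ℝ → ℝ, ContinuousOn F (Icc 0 1) ∧ F =ᵐ[mu] f then h.choose else 0

theorem IsTest.continuous {φ : ℝ → ℝ} (h : IsTest φ) : Continuous φ := h.1.continuous

theorem IsTest.continuous_deriv {φ : ℝ → ℝ} (h : IsTest φ) : Continuous (deriv φ) :=
  h.1.continuous_deriv (by simp)

theorem IsTest.memLp {φ : ℝ → ℝ} (h : IsTest φ) : MemLp φ 2 mu :=
  (h.continuous.memLp_of_hasCompactSupport h.2.1).restrict _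

theorem IsTest.memLp_deriv {φ : ℝ → ℝ} (h : IsTest φ) : MemLp (deriv φ) 2 mu :=
  (h.continuous_deriv.memLp_of_hasCompactSupport h.2.1.deriv).restrict _

theorem IsTest.integral_deriv {φ : ℝ → ℝ} (h : IsTest φ) :
    ∫ x in Ioo (0 : ℝ) 1, deriv φ x = 0 := by
  rw [← integral_Ioc_eq_integral_Ioo, ← intervalIntegral.integral_of_le zero_le_one,
    intervalIntegral.integral_deriv_eq_sub
      (fun x _ => (h.1.differentiable (by simp)).differentiableAt)
      (h.continuous_deriv.intervalIntegrable _ _)]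
  have h0 : φ 0 = 0 := image_eq_zero_of_notMem_tsupport fun hx => lt_irrefl _ (h.2.2 hx).1
  have h1 : φ 1 = 0 := image_eq_zero_of_notMem_tsupport fun hx => lt_irrefl _ (h.2.2 hx).2
  rw [h0, h1, sub_zero]

theorem L2.integrable_mul (f : L2) {g : ℝ → ℝ} (hg : MemLp g 2 mu) :
    Integrable (fun x => f x * g x) mu :=
  (Lp.memLp f).integrable_mul hg

/-- Integration of `L²(0,1)` functions against a fixed `L²(0,1)` function is continuous. -/
theorem L2.continuous_integral_mul {g : ℝ → ℝ} (hg : MemLp g 2 mu) :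
    Continuous fun f : L2 => ∫ x in Ioo (0 : ℝ) 1, f x * g x := by
  have h : (fun f : L2 => ∫ x in Ioo (0 : ℝ) 1, f x * g x)
      = fun f : L2 => inner ℝ (hg.toLp g) f := by
    funext f
    rw [L2.inner_def]
    refine integral_congr_ae ?_
    filter_upwards [hg.coeFn_toLp] with x hx
    simp [hx]
  rw [h]
  fun_prop

/-- The Sobolev space `H¹(0,1)`: pairs `(y, y_x)` in `L²(0,1) × L²(0,1)` in which `y_x` is the weak
derivative of `y`, with the norm `(‖y‖² + ‖y_x‖²)^(1/2)`. -/
def sobolev : Submodule ℝ (WithLp 2 (L2 × L2)) where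
  carrier := {p | IsWeakDeriv p.fst p.snd}
  zero_mem' := by
    intro φ hφ
    have e : ∀ g : ℝ → ℝ, ∫ x in Ioo (0 : ℝ) 1, (0 : L2) x * g x = 0 := by
      intro g
      refine integral_eq_zero_of_ae ?_
      filter_upwards [Lp.coeFn_zero ℝ 2 mu] with x hx
      simp only [hx, Pi.zero_apply, zero_mul]
    simp only [WithLp.zero_fst, WithLp.zero_snd, e, neg_zero]
  add_mem' := by
    intro p q hp hq φ hφ
    have e : ∀ (f₁ f₂ : L2) (g : ℝ → ℝ), MemLp g 2 mu →
        ∫ x in Ioo (0 : ℝ) 1, (f₁ + f₂ : L2) x * g x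
          = (∫ x in Ioo (0 : ℝ) 1, f₁ x * g x) + ∫ x in Ioo (0 : ℝ) 1, f₂ x * g x := by
      intro f₁ f₂ g hg
      rw [← integral_add (L2.integrable_mul f₁ hg) (L2.integrable_mul f₂ hg)]
      refine integral_congr_ae ?_
      filter_upwards [Lp.coeFn_add f₁ f₂] with x hx
      rw [hx, Pi.add_apply, add_mul]
    simp only [WithLp.add_fst, WithLp.add_snd]
    rw [e _ _ _ hφ.memLp_deriv, e _ _ _ hφ.memLp, hp φ hφ, hq φ hφ, neg_add]
  smul_mem' := by
    intro c p hp φ hφ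
    have e : ∀ (f : L2) (g : ℝ → ℝ),
        ∫ x in Ioo (0 : ℝ) 1, (c • f : L2) x * g x = c * ∫ x in Ioo (0 : ℝ) 1, f x * g x := by
      intro f g
      rw [← integral_const_mul]
      refine integral_congr_ae ?_
      filter_upwards [Lp.coeFn_smul c f] with x hx
      simp [hx, mul_assoc]
    simp only [WithLp.smul_fst, WithLp.smul_snd]
    rw [e, e, hp φ hφ, mul_neg]

theorem isClosed_sobolev : IsClosed (sobolev : Set (WithLp 2 (L2 × L2))) := by
  have h : (sobolev : Set (WithLp 2 (L2 × L2))) = ⋂ φ : {φ : ℝ → ℝ // IsTest φ},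
      {p | ∫ x in Ioo (0 : ℝ) 1, p.fst x * deriv φ.1 x
        = -∫ x in Ioo (0 : ℝ) 1, p.snd x * φ.1 x} := by
    ext p
    simp only [mem_iInter, mem_ofPred_eq, Subtype.forall]
    rfl
  rw [h]
  refine isClosed_iInter fun φ => isClosed_eq ?_ ?_
  · exact (L2.continuous_integral_mul φ.2.memLp_deriv).comp (WithLp.continuous_fst 2 L2 L2)
  · exact ((L2.continuous_integral_mul φ.2.memLp).comp (WithLp.continuous_snd 2 L2 L2)).neg

/-- The Hilbert space `H¹(0,1)`. -/
abbrev H1 : Type := sobolev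

instance : CompleteSpace H1 := isClosed_sobolev.completeSpace_coe

/-- The underlying `L²(0,1)` function of an element of `H¹(0,1)`. -/
def H1.fn (y : H1) : L2 := (y : WithLp 2 (L2 × L2)).fst

/-- The (weak) derivative of an element of `H¹(0,1)`. -/
def H1.dx (y : H1) : L2 := (y : WithLp 2 (L2 × L2)).snd

/-- The constant function `c` in `H¹(0,1)`. -/
def H1.const (c : ℝ) : H1 :=
  ⟨WithLp.toLp 2 ((memLp_const c : MemLp (fun _ : ℝ => c) 2 mu).toLp _, 0), by
    intro φ hφ
    have e1 : ∫ x in Ioo (0 : ℝ) 1,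
        ((memLp_const c : MemLp (fun _ : ℝ => c) 2 mu).toLp (fun _ => c) : L2) x * deriv φ x
        = 0 := by
      refine Eq.trans (b := ∫ x in Ioo (0 : ℝ) 1, c * deriv φ x) (integral_congr_ae ?_)
        (by rw [integral_const_mul, hφ.integral_deriv, mul_zero])
      filter_upwards [(memLp_const c : MemLp (fun _ : ℝ => c) 2 mu).coeFn_toLp] with x hx
      rw [hx]
    have e2 : ∫ x in Ioo (0 : ℝ) 1, (0 : L2) x * φ x = 0 := by
      refine integral_eq_zero_of_ae ?_
      filter_upwards [Lp.coeFn_zero ℝ 2 mu] with x hx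
      simp only [hx, Pi.zero_apply, zero_mul]
    exact e1.trans (neg_eq_zero.mpr e2).symm⟩

/-- The state space `𝓗 = H¹(0,1) × L²(0,1) × L²(0,1) × ℝ × ℝ` of states `(y, z, u, ξ, η)`,
a Banach space with (a norm equivalent to) its usual norm. -/
abbrev State : Type := H1 × L2 × L2 × ℝ × ℝ

/-- The component `y` of a state. -/
abbrev State.y (Φ : State) : H1 := Φ.1
/-- The component `z` of a state. -/
abbrev State.z (Φ : State) : L2 := Φ.2.1
/-- The component `u` of a state. -/
abbrev State.u (Φ : State) : L2 := Φ.2.2.1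
/-- The component `ξ` of a state. -/
abbrev State.ξ (Φ : State) : ℝ := Φ.2.2.2.1
/-- The component `η` of a state. -/
abbrev State.η (Φ : State) : ℝ := Φ.2.2.2.2

/-- The data of the overhead crane: modulus of tension `a(x)`, delay `τ`, masses `m` (platform) and
`M` (load), gain `σ` of the distributed damping, gain `α` of the delayed boundary velocity and gain
`β` of the boundary velocity. -/
structure Params where
  a : ℝ → ℝ
  τ : ℝ
  m : ℝ
  M : ℝ
  σ : ℝ
  α : ℝ
  β : ℝ

/-- The function `a y_x`. -/
def Params.flux (p : Params) (y : H1) : ℝ → ℝ := fun x => p.a x * y.dx x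

/-- The domain of the operator `𝓐`:
`y ∈ H²(0,1)`, `z, u ∈ H¹(0,1)`, `ξ = u(0) = z(0)`, `η = z(1)`. -/
def InDomain (Φ : State) : Prop :=
  MemH1 (State.y Φ).dx ∧ MemH1 (State.z Φ) ∧ MemH1 (State.u Φ) ∧
    State.ξ Φ = contRep (State.u Φ) 0 ∧ State.ξ Φ = contRep (State.z Φ) 0 ∧
    State.η Φ = contRep (State.z Φ) 1

/-- The graph of the unbounded operator `𝓐`: `Φ ∈ 𝓓(𝓐)` and `𝓐 Φ = Ψ`, where
`𝓐 (y,z,u,ξ,η) = (z, (a y_x)_x - σ z, -u_x/τ, ((a y_x)(0) - β ξ + α u(1))/m, -(a y_x)(1)/M)`. -/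
def Params.Graph (p : Params) (Φ Ψ : State) : Prop :=
  InDomain Φ ∧
    (State.y Ψ).fn = State.z Φ ∧
    (∃ w : L2, IsWeakDeriv (p.flux (State.y Φ)) w ∧ State.z Ψ = w - p.σ • State.z Φ) ∧
    (∃ v : L2, IsWeakDeriv (State.u Φ) v ∧ State.u Ψ = -(1 / p.τ) • v) ∧
    State.ξ Ψ = 1 / p.m *
      (contRep (p.flux (State.y Φ)) 0 - p.β * State.ξ Φ + p.α * contRep (State.u Φ) 1) ∧
    State.η Ψ = -(contRep (p.flux (State.y Φ)) 1 / p.M)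

/-- `Φ` is a mild solution on `[0,∞)` of `Φ_t = 𝓐 Φ`, `Φ(0) = Φ₀`: it is continuous with values in
`𝓗`, and for all `t ≥ 0` one has `∫₀ᵗ Φ(s) ds ∈ 𝓓(𝓐)` and `Φ(t) = Φ₀ + 𝓐 ∫₀ᵗ Φ(s) ds`. -/
def Params.IsMildSolution (p : Params) (Φ₀ : State) (Φ : ℝ → State) : Prop :=
  ContinuousOn Φ (Ici 0) ∧ Φ 0 = Φ₀ ∧
    ∀ t : ℝ, 0 ≤ t → p.Graph (∫ s in (0 : ℝ)..t, Φ s) (Φ t - Φ₀)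

/-- `∫₀¹ (σ y + z + α τ u) dx + m ξ + M η + (β - α) y(0)`. -/
def Params.functional (p : Params) (Φ : State) : ℝ :=
  (∫ x in Ioo (0 : ℝ) 1,
      (p.σ * (State.y Φ).fn x + State.z Φ x + p.α * p.τ * State.u Φ x))
    + p.m * State.ξ Φ + p.M * State.η Φ + (p.β - p.α) * contRep (State.y Φ).fn 0

/-- The inner product of `𝓗` adapted to the system, with parameters `K` and `ϖ`. -/
def Params.innerH (p : Params) (K ϖ : ℝ) (Φ Ψ : State) : ℝ :=
  (∫ x in Ioo (0 : ℝ) 1,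
      (p.a x * (State.y Φ).dx x * (State.y Ψ).dx x + State.z Φ x * State.z Ψ x))
    + K * p.τ * (∫ x in Ioo (0 : ℝ) 1, State.u Φ x * State.u Ψ x)
    + p.m * State.ξ Φ * State.ξ Ψ + p.M * State.η Φ * State.η Ψ
    + ϖ * p.functional Φ * p.functional Ψ

/-- The equilibrium state `(c, 0, 0, 0, 0)`. -/
def equilibrium (c : ℝ) : State := (H1.const c, 0, 0, 0, 0)

end

end Crane

/-!
Every mild solution is shown to converge by a Lyapunov argument that uses neither the generation of
a semigroup nor compactness of trajectories.

The energy `V(Φ) = ∫₀¹ (a y_x² + z²) + K τ ∫₀¹ u² + m ξ² + M η²` has a bilinear form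
`⟨Φ, Ψ⟩`, the given inner product without its `ℓ` term, with, for `Ψ = 𝓐 Φ`,
`⟨Φ, Ψ⟩ = -σ ‖z‖² - (K/2) u(1)² + (K/2 - β) ξ² + α ξ u(1)` (`Params.energyB_eq`, by Green's formula),
and `|α| < K < 2β - |α|` bounds the right-hand side by `-c D` with `D = ‖z‖² + ξ² + u(1)²`
(`Params.exists_energyB_le`). The energy thus does not increase, and `D` is integrable in time.

For a solution smooth in time, `D` is integrable for its time derivatives too, and these control what
`D` misses. The equation gives `(a y_x)_x = z_t + σ z` and `(a y_x)(0) = m ξ_t + β ξ - α u(1)`, hence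
a bound on `y_x` (`Params.exists_norm_dx_sq_le`). The same bound for the time derivative controls
`z_x`, hence `η = z(1) = ξ + ∫₀¹ z_x` (`Params.eta_sq_le`). The transport equation gives
`d/dt τ ∫₀¹ (1 - x) u² = ξ² - ‖u‖²` (`Params.hasDerivAt_delayWeight`). A suitable combination `L` of
these quantities has `L' ≤ -V`, and as `V` is nonincreasing, `t V(t) ≤ L(0)`
(`Params.tendsto_energy_of_smooth`).

A mild solution is reduced to this case by averaging over time windows `[t, t + h]`: the average of a
mild solution is a strong one, whose derivative is a difference quotient, and the energy of the
difference between the two is at most its value at time `0`, which vanishes as `h → 0`. Three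
averages give the required smoothness (`IsMild.tendsto_of_smooth`). For this the graph of `𝓐` has to
be closed, so it is replaced by an explicitly closed subspace `Params.graph` containing it, in which
the traces are written as continuous functionals of a Sobolev function and its weak derivative.

Finally `ℓ` vanishes on the range of `𝓐` (`Params.ellL_eq_zero`), so it is conserved. Once the energy
has decayed, `y` is close to a constant by the Poincaré inequality, and the conserved value of `ℓ`
identifies this constant as `ζ` (`Params.tendsto_equilibrium`).
-/

namespace Crane

noncomputable section

/-! ### Sobolev functions on the unit interval -/

theorem integral_Ioo_eq_intervalIntegral (f : ℝ → ℝ) :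
    ∫ x in Ioo (0 : ℝ) 1, f x = ∫ x in (0 : ℝ)..1, f x := by
  rw [intervalIntegral.integral_of_le zero_le_one, integral_Ioc_eq_integral_Ioo]

theorem intervalIntegrable_of_memLp {f : ℝ → ℝ} (hf : MemLp f 2 mu) :
    IntervalIntegrable f volume 0 1 := by
  rw [intervalIntegrable_iff_integrableOn_Ioo_of_le zero_le_one]
  exact hf.integrable one_le_two

/-- Integration by parts for primitives of integrable functions. -/
theorem integral_primitive_mul {g h : ℝ → ℝ} (hg : IntervalIntegrable g volume 0 1)
    (hh : IntervalIntegrable h volume 0 1) (c d : ℝ) :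
    ∫ x in (0 : ℝ)..1, g x * (d + ∫ t in (0 : ℝ)..x, h t) + (c + ∫ t in (0 : ℝ)..x, g t) * h x
      = (c + ∫ t in (0 : ℝ)..1, g t) * (d + ∫ t in (0 : ℝ)..1, h t) - c * d := by
  have ac : ∀ {g : ℝ → ℝ} (_ : IntervalIntegrable g volume 0 1) (c : ℝ),
      AbsolutelyContinuousOnInterval (fun x => c + ∫ t in (0 : ℝ)..x, g t) 0 1 := fun hg c =>
    (contDiff_const (c := c)).contDiffOn.absolutelyContinuousOnInterval.fun_add
      (hg.absolutelyContinuousOnInterval_intervalIntegral (by simp))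
  have e := (ac hg c).integral_deriv_mul_eq_sub (ac hh d)
  simp only [intervalIntegral.integral_same, add_zero] at e
  rw [← e]
  refine intervalIntegral.integral_congr_ae ?_
  filter_upwards [hg.ae_hasDerivAt_integral, hh.ae_hasDerivAt_integral] with x h1 h2 hx
  have hx' : x ∈ uIcc (0 : ℝ) 1 := uIoc_subset_uIcc hx
  rw [((h1 hx' 0 (by simp)).const_add c).deriv, ((h2 hx' 0 (by simp)).const_add d).deriv]

theorem isWeakDeriv_primitive {g : ℝ → ℝ} (hg : MemLp g 2 mu) :
    IsWeakDeriv (fun x => ∫ t in (0 : ℝ)..x, g t) g := by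
  intro φ hφ
  have hd : IntervalIntegrable (deriv φ) volume 0 1 := hφ.continuous_deriv.intervalIntegrable _ _
  have hgi := intervalIntegrable_of_memLp hg
  have h0 : φ 0 = 0 := image_eq_zero_of_notMem_tsupport fun hx => lt_irrefl _ (hφ.2.2 hx).1
  have h1 : φ 1 = 0 := image_eq_zero_of_notMem_tsupport fun hx => lt_irrefl _ (hφ.2.2 hx).2
  have hp : ∀ x, ∫ t in (0 : ℝ)..x, deriv φ t = φ x := fun x => by
    rw [intervalIntegral.integral_deriv_eq_sub
      (fun x _ => (hφ.1.differentiable (by simp)).differentiableAt)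
      (hφ.continuous_deriv.intervalIntegrable _ _), h0, sub_zero]
  have e := integral_primitive_mul hgi hd 0 0
  simp only [hp, zero_add, h1, mul_zero, sub_zero] at e
  rw [intervalIntegral.integral_add (hgi.mul_continuousOn hφ.continuous.continuousOn)
    (hd.continuousOn_mul (intervalIntegral.continuousOn_primitive_interval' hgi (by simp)))] at e
  rw [integral_Ioo_eq_intervalIntegral, integral_Ioo_eq_intervalIntegral]
  linarith

/-- A primitive of a test function of integral zero, vanishing at `0`, is a test function. -/
theorem IsTest.primitive {ρ : ℝ → ℝ} (h : IsTest ρ) (h0 : ∫ x in (0 : ℝ)..1, ρ x = 0) :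
    IsTest (fun x => ∫ t in (0 : ℝ)..x, ρ t) ∧
      deriv (fun x => ∫ t in (0 : ℝ)..x, ρ t) = ρ := by
  have hd : ∀ x, HasDerivAt (fun x => ∫ t in (0 : ℝ)..x, ρ t) (ρ x) x := fun x =>
    intervalIntegral.integral_hasDerivAt_right (h.continuous.intervalIntegrable _ _)
      (h.continuous.stronglyMeasurableAtFilter _ _) h.continuous.continuousAt
  have hd' : deriv (fun x => ∫ t in (0 : ℝ)..x, ρ t) = ρ := funext fun x => (hd x).deriv
  refine ⟨?_, hd'⟩
  obtain ⟨ε, hε, hK⟩ := h.2.1.isCompact.exists_forall_le' (f := fun x => min x (1 - x))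
    (a := (0 : ℝ)) (by fun_prop) fun x hx => by
      have := h.2.2 hx
      exact lt_min this.1 (by linarith [this.2])
  have hz : ∀ x, ρ x ≠ 0 → ε ≤ x ∧ ε ≤ 1 - x := fun x hx =>
    le_min_iff.1 (hK x (subset_tsupport _ hx))
  have hsub : Function.support (fun x => ∫ t in (0 : ℝ)..x, ρ t) ⊆ Icc ε (1 - ε) := by
    intro x hx
    by_contra hcon
    apply hx
    rcases lt_or_ge x ε with hlt | hge
    · refine (intervalIntegral.integral_congr (g := fun _ => (0 : ℝ)) fun t ht => ?_).trans
        (by simp)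
      by_contra hne
      have := (hz t hne).1
      have : t ≤ max 0 x := ht.2
      exact absurd (max_lt hε hlt) (by linarith)
    · have hx1 : 1 - ε < x := by
        by_contra hle
        exact hcon ⟨hge, not_lt.1 hle⟩
      have h1 : ∫ t in x..1, ρ t = 0 := by
        refine (intervalIntegral.integral_congr (g := fun _ => (0 : ℝ)) fun t ht => ?_).trans
          (by simp)
        by_contra hne
        have := (hz t hne).2
        have : min x 1 ≤ t := ht.1
        exact absurd (lt_min hx1 (by linarith : 1 - ε < 1)) (by linarith)
      have := intervalIntegral.integral_add_adjacent_intervals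
        (h.continuous.intervalIntegrable (μ := volume) 0 x)
        (h.continuous.intervalIntegrable (μ := volume) x 1)
      show ∫ t in (0 : ℝ)..x, ρ t = 0
      linarith
  have hts := closure_minimal hsub isClosed_Icc
  refine ⟨contDiff_infty_iff_deriv.2 ⟨fun x => (hd x).differentiableAt, ?_⟩, ?_, ?_⟩
  · rw [hd']; exact h.1
  · exact isCompact_Icc.of_isClosed_subset (isClosed_tsupport _) hts
  · exact hts.trans fun x hx => ⟨by linarith [hx.1], by linarith [hx.2]⟩

theorem exists_isTest_integral_eq_one : ∃ χ : ℝ → ℝ, IsTest χ ∧ ∫ x in (0 : ℝ)..1, χ x = 1 := by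
  let b : ContDiffBump (1 / 2 : ℝ) := ⟨1 / 8, 1 / 4, by norm_num, by norm_num⟩
  have hsub : tsupport (b.normed volume) ⊆ Ioo (0 : ℝ) 1 := by
    rw [b.tsupport_normed_eq, Real.closedBall_eq_Icc]
    exact fun x hx => ⟨by linarith [hx.1, show b.rOut = 1 / 4 from rfl],
      by linarith [hx.2, show b.rOut = 1 / 4 from rfl]⟩
  refine ⟨b.normed volume, ⟨b.contDiff_normed, b.hasCompactSupport_normed, hsub⟩, ?_⟩
  rw [← integral_Ioo_eq_intervalIntegral,
    setIntegral_eq_integral_of_forall_compl_eq_zero fun x hx =>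
      image_eq_zero_of_notMem_tsupport fun h => hx (hsub h)]
  exact b.integral_normed

/-- The lemma of du Bois-Reymond. -/
theorem ae_const_of_isWeakDeriv_zero {k : ℝ → ℝ} (hk : MemLp k 2 mu)
    (h : ∀ φ, IsTest φ → ∫ x in Ioo (0 : ℝ) 1, k x * deriv φ x = 0) :
    ∃ c : ℝ, k =ᵐ[mu] fun _ => c := by
  obtain ⟨χ, hχ, hχ1⟩ := exists_isTest_integral_eq_one
  have hint : ∀ {k}, MemLp k 2 mu → ∀ {ψ}, IsTest ψ →
      Integrable (fun x => k x * ψ x) mu := fun hk _ hψ => hk.integrable_mul hψ.memLp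
  refine ⟨∫ x in Ioo (0 : ℝ) 1, k x * χ x, ?_⟩
  set c := ∫ x in Ioo (0 : ℝ) 1, k x * χ x with hc
  have hkc : MemLp (fun x => k x - c) 2 mu := hk.sub (memLp_const c)
  have key := isOpen_Ioo.ae_eq_zero_of_integral_contDiff_smul_eq_zero (U := Ioo (0 : ℝ) 1)
    (μ := mu) (f := fun x => k x - c)
    ((hkc.integrable one_le_two).locallyIntegrable.locallyIntegrableOn _) ?_
  · have hmem : ∀ᵐ x ∂mu, x ∈ Ioo (0 : ℝ) 1 := ae_restrict_mem measurableSet_Ioo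
    filter_upwards [key, hmem] with x hx hx1
    linarith [hx hx1]
  · intro ψ h1 h2 h3
    have hψ : IsTest ψ := ⟨h1, h2, h3⟩
    set I := ∫ x in (0 : ℝ)..1, ψ x with hI
    -- `ψ - I χ` has integral zero, hence is the derivative of a test function.
    have hρ : IsTest (fun x => ψ x - I * χ x) := by
      refine ⟨hψ.1.sub (contDiff_const.mul hχ.1), ?_, ?_⟩
      · exact hψ.2.1.sub (hχ.2.1.mul_left (f := fun _ => I))
      · refine (tsupport_sub ψ (fun x => I * χ x)).trans (union_subset hψ.2.2 ?_)
        exact (tsupport_mul_subset_right (f := fun _ => I) (g := χ)).trans hχ.2.2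
    have h0 : ∫ x in (0 : ℝ)..1, (ψ x - I * χ x) = 0 := by
      rw [intervalIntegral.integral_sub (hψ.continuous.intervalIntegrable _ _)
        ((hχ.continuous.const_mul I).intervalIntegrable _ _),
        intervalIntegral.integral_const_mul, hχ1]
      ring
    have e := h _ (hρ.primitive h0).1
    rw [(hρ.primitive h0).2] at e
    have e1 : ∫ x in Ioo (0 : ℝ) 1, k x * (ψ x - I * χ x)
        = (∫ x in Ioo (0 : ℝ) 1, k x * ψ x) - I * c := by
      rw [hc, ← integral_const_mul, ← integral_sub (hint hk hψ) ((hint hk hχ).const_mul I)]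
      congr 1; ext x; ring
    have e2 : ∫ x in Ioo (0 : ℝ) 1, ψ x • (k x - c)
        = (∫ x in Ioo (0 : ℝ) 1, k x * ψ x) - c * I := by
      rw [hI, ← integral_Ioo_eq_intervalIntegral, ← integral_const_mul,
        ← integral_sub (hint hk hψ) ((hψ.memLp.integrable one_le_two).const_mul c)]
      congr 1; ext x; simp only [smul_eq_mul]; ring
    rw [e2]; linarith

theorem memLp_of_continuousOn {F : ℝ → ℝ} (hF : ContinuousOn F (Icc 0 1)) : MemLp F 2 mu := by
  obtain ⟨C, hC⟩ := isCompact_Icc.exists_bound_of_continuousOn hF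
  refine MemLp.of_bound ((hF.mono Ioo_subset_Icc_self).aestronglyMeasurable measurableSet_Ioo) C ?_
  filter_upwards [ae_restrict_mem measurableSet_Ioo] with x hx
  exact hC x (Ioo_subset_Icc_self hx)

theorem continuousOn_primitive {g : ℝ → ℝ} (hg : MemLp g 2 mu) (c : ℝ) :
    ContinuousOn (fun x => c + ∫ t in (0 : ℝ)..x, g t) (Icc 0 1) := by
  have := intervalIntegral.continuousOn_primitive_interval' (intervalIntegrable_of_memLp hg)
    (a := 0) (by simp)
  rw [uIcc_of_le zero_le_one] at this
  exact continuousOn_const.add this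

/-- A Sobolev function on `(0,1)` is a primitive of its weak derivative. -/
theorem IsWeakDeriv.exists_ae_eq_primitive {f g : ℝ → ℝ} (hf : MemLp f 2 mu) (hg : MemLp g 2 mu)
    (h : IsWeakDeriv f g) : ∃ c : ℝ, f =ᵐ[mu] fun x => c + ∫ t in (0 : ℝ)..x, g t := by
  have hP : MemLp (fun x => ∫ t in (0 : ℝ)..x, g t) 2 mu := by
    simpa using memLp_of_continuousOn (continuousOn_primitive hg 0)
  obtain ⟨c, hc⟩ := ae_const_of_isWeakDeriv_zero (hf.sub hP) fun φ hφ => by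
    have e1 := h φ hφ
    have e2 := isWeakDeriv_primitive hg φ hφ
    simp only [Pi.sub_apply, sub_mul]
    exact (integral_sub (hf.integrable_mul hφ.memLp_deriv)
      (hP.integrable_mul hφ.memLp_deriv)).trans (sub_eq_zero.2 (e1.trans e2.symm))
  refine ⟨c, ?_⟩
  filter_upwards [hc] with x hx
  simp only [Pi.sub_apply] at hx
  linarith

theorem eqOn_Icc_of_ae_eq {F G : ℝ → ℝ} (hF : ContinuousOn F (Icc 0 1))
    (hG : ContinuousOn G (Icc 0 1)) (h : F =ᵐ[mu] G) : EqOn F G (Icc 0 1) := by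
  have h1 : F =ᵐ[volume.restrict (Icc (0 : ℝ) 1)] G := by
    rw [← restrict_Ioo_eq_restrict_Icc]
    exact h
  exact Measure.eqOn_Icc_of_ae_eq volume zero_ne_one h1 hF hG

/-! ### Traces at the endpoints, Green's formula and the Poincaré inequality -/

/-- The element of `L²(0,1)` given by a continuous function on `[0,1]`. -/
def ofCont (F : ℝ → ℝ) (hF : ContinuousOn F (Icc 0 1)) : L2 := (memLp_of_continuousOn hF).toLp F

theorem coeFn_ofCont (F : ℝ → ℝ) (hF : ContinuousOn F (Icc 0 1)) : ofCont F hF =ᵐ[mu] F :=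
  MemLp.coeFn_toLp _

/-- The constant function `1`. -/
def one : L2 := ofCont (fun _ => 1) continuousOn_const

/-- The function `x`. -/
def idL2 : L2 := ofCont (fun x => x) continuousOn_id

theorem coeFn_one : one =ᵐ[mu] fun _ => 1 := coeFn_ofCont _ _

theorem coeFn_idL2 : idL2 =ᵐ[mu] fun x => x := coeFn_ofCont _ _

theorem L2_inner_eq (f g : L2) : inner ℝ f g = ∫ x in (0 : ℝ)..1, f x * g x := by
  rw [L2.inner_def, ← integral_Ioo_eq_intervalIntegral]
  refine integral_congr_ae (ae_of_all _ fun x => ?_)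
  simp [mul_comm]

theorem L2_inner_eq_of_ae {f g : L2} {F G : ℝ → ℝ} (hf : f =ᵐ[mu] F) (hg : g =ᵐ[mu] G) :
    inner ℝ f g = ∫ x in (0 : ℝ)..1, F x * G x := by
  rw [L2_inner_eq, ← integral_Ioo_eq_intervalIntegral, ← integral_Ioo_eq_intervalIntegral]
  refine integral_congr_ae ?_
  filter_upwards [hf, hg] with x h1 h2
  rw [h1, h2]

theorem inner_one (f : L2) : inner ℝ one f = ∫ x in (0 : ℝ)..1, f x := by
  rw [L2_inner_eq_of_ae coeFn_one (EventuallyEq.refl _ _)]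
  simp

theorem norm_one_L2 : ‖one‖ = 1 := by
  have h : inner ℝ one one = (1 : ℝ) := by
    rw [L2_inner_eq_of_ae coeFn_one coeFn_one]
    simp
  rw [real_inner_self_eq_norm_sq] at h
  nlinarith [norm_nonneg one]

/-- The value at `1` of a Sobolev function `f` with weak derivative `g`, as a continuous linear
functional of the pair `(f, g)`: `f(1) = ∫₀¹ (f + x g) dx`. -/
def ev1 : L2 × L2 →L[ℝ] ℝ :=
  (innerSL ℝ one).comp (ContinuousLinearMap.fst ℝ L2 L2)
    + (innerSL ℝ idL2).comp (ContinuousLinearMap.snd ℝ L2 L2)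

/-- The value at `0` of a Sobolev function `f` with weak derivative `g`, as a continuous linear
functional of the pair `(f, g)`: `f(0) = f(1) - ∫₀¹ g dx`. -/
def ev0 : L2 × L2 →L[ℝ] ℝ :=
  ev1 - (innerSL ℝ one).comp (ContinuousLinearMap.snd ℝ L2 L2)

theorem ev1_apply (f g : L2) : ev1 (f, g) = inner ℝ one f + inner ℝ idL2 g := by
  simp [ev1]

theorem ev0_apply (f g : L2) : ev0 (f, g) = ev1 (f, g) - inner ℝ one g := by
  simp [ev0]

theorem ev_of_ae_eq_primitive {f g : L2} {c : ℝ}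
    (h : f =ᵐ[mu] fun x => c + ∫ t in (0 : ℝ)..x, g t) :
    ev0 (f, g) = c ∧ ev1 (f, g) = c + ∫ t in (0 : ℝ)..1, g t := by
  have hg := intervalIntegrable_of_memLp (Lp.memLp g)
  have e := integral_primitive_mul hg (intervalIntegrable_const (c := (1 : ℝ))) c 0
  simp only [zero_add, intervalIntegral.integral_const, smul_eq_mul, mul_one, sub_zero,
    mul_zero] at e
  have e1 : ev1 (f, g) = c + ∫ t in (0 : ℝ)..1, g t := by
    have hi : IntervalIntegrable (fun x => c + ∫ t in (0 : ℝ)..x, g t) volume 0 1 :=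
      (uIcc_of_le (zero_le_one (α := ℝ)) ▸
        continuousOn_primitive (Lp.memLp g) c).intervalIntegrable
    rw [ev1_apply, L2_inner_eq_of_ae coeFn_one h,
      L2_inner_eq_of_ae coeFn_idL2 (EventuallyEq.refl _ _), ← e,
      intervalIntegral.integral_add (hg.mul_continuousOn (g := fun x => x) continuousOn_id)
      hi, add_comm]
    simp only [one_mul, mul_comm]
  refine ⟨?_, e1⟩
  rw [ev0_apply, e1, inner_one]
  ring

theorem IsWeakDeriv.ae_eq_primitive {f g : L2} (h : IsWeakDeriv f g) :
    f =ᵐ[mu] fun x => ev0 (f, g) + ∫ t in (0 : ℝ)..x, g t := by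
  obtain ⟨c, hc⟩ := h.exists_ae_eq_primitive (Lp.memLp f) (Lp.memLp g)
  rwa [(ev_of_ae_eq_primitive hc).1]

theorem IsWeakDeriv.congr {f f' g g' : ℝ → ℝ} (hf : f =ᵐ[mu] f') (hg : g =ᵐ[mu] g')
    (h : IsWeakDeriv f g) : IsWeakDeriv f' g' := by
  intro φ hφ
  have e1 : ∫ x in Ioo (0 : ℝ) 1, f x * deriv φ x = ∫ x in Ioo (0 : ℝ) 1, f' x * deriv φ x :=
    integral_congr_ae (by filter_upwards [hf] with x hx; rw [hx])
  have e2 : ∫ x in Ioo (0 : ℝ) 1, g x * φ x = ∫ x in Ioo (0 : ℝ) 1, g' x * φ x :=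
    integral_congr_ae (by filter_upwards [hg] with x hx; rw [hx])
  rw [← e1, ← e2]
  exact h φ hφ

theorem IsWeakDeriv.ev_eq {f g : L2} (h : IsWeakDeriv f g) {F : ℝ → ℝ}
    (hF : ContinuousOn F (Icc 0 1)) (hFf : F =ᵐ[mu] f) :
    ev0 (f, g) = F 0 ∧ ev1 (f, g) = F 1 := by
  have e := eqOn_Icc_of_ae_eq hF (continuousOn_primitive (Lp.memLp g) (ev0 (f, g)))
    (hFf.trans h.ae_eq_primitive)
  refine ⟨?_, ?_⟩
  · rw [e ⟨le_rfl, zero_le_one⟩]; simp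
  · rw [e ⟨zero_le_one, le_rfl⟩]; exact (ev_of_ae_eq_primitive h.ae_eq_primitive).2

/-- The traces are the endpoint values of the continuous representative. -/
theorem IsWeakDeriv.contRep_eq {f g : L2} (h : IsWeakDeriv f g) {f' : ℝ → ℝ} (hf : f' =ᵐ[mu] f) :
    contRep f' 0 = ev0 (f, g) ∧ contRep f' 1 = ev1 (f, g) := by
  have hex : ∃ F : ℝ → ℝ, ContinuousOn F (Icc 0 1) ∧ F =ᵐ[mu] f' :=
    ⟨_, continuousOn_primitive (Lp.memLp g) (ev0 (f, g)),
      (hf.trans h.ae_eq_primitive).symm⟩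
  rw [contRep, dif_pos hex]
  have := h.ev_eq hex.choose_spec.1 (hex.choose_spec.2.trans hf)
  exact ⟨this.1.symm, this.2.symm⟩

/-- Green's formula. -/
theorem IsWeakDeriv.green {f g f' g' : L2} (h : IsWeakDeriv f g) (h' : IsWeakDeriv f' g') :
    inner ℝ g f' + inner ℝ f g' = ev1 (f, g) * ev1 (f', g') - ev0 (f, g) * ev0 (f', g') := by
  have hg := intervalIntegrable_of_memLp (Lp.memLp g)
  have hg' := intervalIntegrable_of_memLp (Lp.memLp g')
  have hc : ∀ (k : L2) (c : ℝ), ContinuousOn (fun x => c + ∫ t in (0 : ℝ)..x, k t) (uIcc 0 1) :=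
    fun k c => uIcc_of_le (zero_le_one (α := ℝ)) ▸ continuousOn_primitive (Lp.memLp k) c
  have e := integral_primitive_mul hg hg' (ev0 (f, g)) (ev0 (f', g'))
  rw [(ev_of_ae_eq_primitive h.ae_eq_primitive).2, (ev_of_ae_eq_primitive h'.ae_eq_primitive).2,
    ← e, intervalIntegral.integral_add (hg.mul_continuousOn (hc g' _))
      (hg'.continuousOn_mul (hc g _)),
    L2_inner_eq_of_ae (EventuallyEq.refl _ _) h'.ae_eq_primitive,
    L2_inner_eq_of_ae h.ae_eq_primitive (EventuallyEq.refl _ _)]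

theorem ev1_sub_ev0 (f g : L2) : ev1 (f, g) - ev0 (f, g) = inner ℝ one g := by
  rw [ev0_apply]; ring

theorem abs_ev1_sub_ev0_le (f g : L2) : |ev1 (f, g) - ev0 (f, g)| ≤ ‖g‖ := by
  rw [ev1_sub_ev0]
  simpa [norm_one_L2] using abs_real_inner_le_norm one g

/-- The Poincaré inequality. -/
theorem IsWeakDeriv.norm_sub_le {f g : L2} (h : IsWeakDeriv f g) :
    ‖f - ev0 (f, g) • one‖ ≤ ‖g‖ := by
  have hgi : Integrable (fun x => ‖g x‖) mu := ((Lp.memLp g).integrable one_le_two).norm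
  have hL1 : ∫ x in Ioo (0 : ℝ) 1, ‖g x‖ ≤ ‖g‖ := by
    have e : ∫ x in Ioo (0 : ℝ) 1, ‖g x‖ = inner ℝ one (Lp.memLp g).norm.toLp := by
      rw [inner_one, ← integral_Ioo_eq_intervalIntegral]
      exact integral_congr_ae (MemLp.coeFn_toLp _).symm
    rw [e]
    refine (real_inner_le_norm _ _).trans_eq ?_
    rw [norm_one_L2, one_mul, Lp.norm_toLp, eLpNorm_norm, Lp.norm_def]
  have hb : ∀ᵐ x ∂mu, ‖(f - ev0 (f, g) • one : L2) x‖ ≤ ‖g‖ := by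
    filter_upwards [h.ae_eq_primitive, Lp.coeFn_sub f (ev0 (f, g) • one),
      Lp.coeFn_smul (ev0 (f, g)) one, coeFn_one,
      ae_restrict_mem measurableSet_Ioo] with x h1 h2 h3 h4 hx
    have e : (f - ev0 (f, g) • one : L2) x = ∫ t in (0 : ℝ)..x, g t := by
      rw [h2, Pi.sub_apply, h3, Pi.smul_apply, h4, h1]
      simp
    rw [e]
    refine le_trans ?_ hL1
    rw [intervalIntegral.integral_of_le hx.1.le]
    refine (norm_integral_le_integral_norm _).trans ?_
    refine setIntegral_mono_set hgi (ae_of_all _ fun _ => norm_nonneg _) ?_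
    exact (show Ioc (0 : ℝ) x ⊆ Ioo 0 1 from
      fun t ht => ⟨ht.1, ht.2.trans_lt hx.2⟩).eventuallyLE
  have := Lp.norm_le_of_ae_bound (norm_nonneg g) hb
  simpa [measureUnivNNReal] using this

/-! ### Multiplication operators -/

theorem exists_mulL (F : ℝ → ℝ) (hF : ContinuousOn F (Icc 0 1)) :
    ∃ T : L2 →L[ℝ] L2, ∀ g : L2, T g =ᵐ[mu] fun x => F x * g x := by
  obtain ⟨C, hC⟩ := isCompact_Icc.exists_bound_of_continuousOn hF
  have hm : MemLp F ⊤ mu := by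
    refine memLp_top_of_bound
      ((hF.mono Ioo_subset_Icc_self).aestronglyMeasurable measurableSet_Ioo) C ?_
    filter_upwards [ae_restrict_mem measurableSet_Ioo] with x hx
    exact hC x (Ioo_subset_Icc_self hx)
  refine ⟨(ContinuousLinearMap.mul ℝ ℝ).holderL mu ⊤ 2 2 (hm.toLp F), fun g => ?_⟩
  rw [ContinuousLinearMap.holderL_apply_apply]
  filter_upwards [(ContinuousLinearMap.mul ℝ ℝ).coeFn_holder (r := 2) (hm.toLp F) g,
    hm.coeFn_toLp] with x h1 h2
  rw [h1, h2]
  rfl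

/-- Multiplication by a continuous function, as an operator on `L²(0,1)`. -/
def mulL (F : ℝ → ℝ) (hF : ContinuousOn F (Icc 0 1)) : L2 →L[ℝ] L2 := (exists_mulL F hF).choose

theorem coeFn_mulL (F : ℝ → ℝ) (hF : ContinuousOn F (Icc 0 1)) (g : L2) :
    mulL F hF g =ᵐ[mu] fun x => F x * g x := (exists_mulL F hF).choose_spec g

theorem inner_mulL (F : ℝ → ℝ) (hF : ContinuousOn F (Icc 0 1)) (f g : L2) :
    inner ℝ (mulL F hF f) g = ∫ x in Ioo (0 : ℝ) 1, F x * f x * g x := by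
  rw [L2_inner_eq_of_ae (coeFn_mulL F hF f) (EventuallyEq.refl _ _),
    integral_Ioo_eq_intervalIntegral]

theorem inner_mulL_comm (F : ℝ → ℝ) (hF : ContinuousOn F (Icc 0 1)) (f g : L2) :
    inner ℝ (mulL F hF f) g = inner ℝ f (mulL F hF g) := by
  rw [real_inner_comm _ f, inner_mulL, inner_mulL]
  congr 1; ext x; ring

theorem le_inner_mulL {F : ℝ → ℝ} (hF : ContinuousOn F (Icc 0 1)) {c : ℝ}
    (hc : ∀ x ∈ Icc (0 : ℝ) 1, c ≤ F x) (g : L2) :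
    c * ‖g‖ ^ 2 ≤ inner ℝ (mulL F hF g) g := by
  have hi : ∀ f : L2, Integrable (fun x => f x * g x) mu := fun f =>
    (Lp.memLp f).integrable_mul (Lp.memLp g)
  rw [← real_inner_self_eq_norm_sq, L2_inner_eq, L2_inner_eq, ← integral_Ioo_eq_intervalIntegral,
    ← integral_Ioo_eq_intervalIntegral, ← integral_const_mul]
  refine integral_mono_ae ((hi g).const_mul c) (hi _) ?_
  filter_upwards [coeFn_mulL F hF g, ae_restrict_mem measurableSet_Ioo] with x h1 hx
  rw [h1]
  nlinarith [mul_le_mul_of_nonneg_right (hc x (Ioo_subset_Icc_self hx)) (mul_self_nonneg (g x))]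

/-- The function `1 - x`. -/
def oneSub : ℝ → ℝ := fun x => 1 - x

theorem continuousOn_oneSub : ContinuousOn oneSub (Icc 0 1) := by
  unfold oneSub; fun_prop

/-- The product rule for `(1 - x) f`. -/
theorem IsWeakDeriv.oneSub_mul {f g : L2} (h : IsWeakDeriv f g) :
    IsWeakDeriv (mulL oneSub continuousOn_oneSub f) 
      (mulL oneSub continuousOn_oneSub g - f : L2) := by
  have h' : IsWeakDeriv (fun x => oneSub x * f x) (fun x => oneSub x * g x - f x) := by
    intro φ hφ
    -- `(1 - x) φ` is again a test function.
    have hψ : IsTest (fun x => (1 - x) * φ x) :=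
      ⟨(contDiff_const.sub contDiff_id).mul hφ.1, hφ.2.1.mul_left,
        (tsupport_mul_subset_right (f := fun x : ℝ => 1 - x) (g := φ)).trans hφ.2.2⟩
    have hd : deriv (fun x => (1 - x) * φ x) = fun x => (1 - x) * deriv φ x - φ x := by
      funext x
      have h1 := (hφ.1.differentiable (by simp) x).hasDerivAt
      have h2 : HasDerivAt (fun x => (1 - x) * φ x) (-1 * φ x + (1 - x) * deriv φ x) x :=
        ((hasDerivAt_id x).const_sub 1).mul h1
      rw [h2.deriv]
      ring
    have e := h _ hψ
    rw [hd] at e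
    have hfφ : Integrable (fun x => f x * φ x) mu := (Lp.memLp f).integrable_mul hφ.memLp
    have hlin : MemLp oneSub ⊤ mu := by
      refine memLp_top_of_bound (by unfold oneSub; fun_prop) 1 ?_
      filter_upwards [ae_restrict_mem measurableSet_Ioo] with x hx
      rw [oneSub, Real.norm_eq_abs, abs_le]
      constructor <;> linarith [hx.1, hx.2]
    have h3 : Integrable (fun x => oneSub x * f x * deriv φ x) mu :=
      ((Lp.memLp f).mul (r := 2) hlin).integrable_mul hφ.memLp_deriv
    have h4 : Integrable (fun x => oneSub x * g x * φ x) mu :=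
      ((Lp.memLp g).mul (r := 2) hlin).integrable_mul hφ.memLp
    have e1 : ∫ x in Ioo (0 : ℝ) 1, f x * ((1 - x) * deriv φ x - φ x)
        = (∫ x in Ioo (0 : ℝ) 1, oneSub x * f x * deriv φ x)
          - ∫ x in Ioo (0 : ℝ) 1, f x * φ x := by
      rw [← integral_sub h3 hfφ]
      congr 1; ext x; rw [oneSub]; ring
    have e2 : ∫ x in Ioo (0 : ℝ) 1, (oneSub x * g x - f x) * φ x
        = (∫ x in Ioo (0 : ℝ) 1, g x * ((1 - x) * φ x)) - ∫ x in Ioo (0 : ℝ) 1, f x * φ x := by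
      have : (fun x => g x * ((1 - x) * φ x)) = fun x => oneSub x * g x * φ x := by
        ext x; rw [oneSub]; ring
      rw [this, ← integral_sub h4 hfφ]
      congr 1; ext x; ring
    rw [e2]
    linarith
  refine h'.congr (coeFn_mulL _ _ f).symm ?_
  filter_upwards [Lp.coeFn_sub (mulL oneSub continuousOn_oneSub g) f,
    coeFn_mulL oneSub continuousOn_oneSub g] with x h1 h2
  rw [h1, Pi.sub_apply, h2]

/-- The multiplier identity behind the decay of a transported quantity: pairing the derivative of
`f` with `(1 - x) f` controls the norm of `f` by its value at the inflow end. -/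
theorem IsWeakDeriv.two_mul_inner_oneSub {f g : L2} (h : IsWeakDeriv f g) :
    2 * inner ℝ (mulL oneSub continuousOn_oneSub f) g = ‖f‖ ^ 2 - ev0 (f, g) ^ 2 := by
  have hF := continuousOn_primitive (Lp.memLp g) (ev0 (f, g))
  have hev := h.oneSub_mul.ev_eq (continuousOn_oneSub.mul hF) (by
    filter_upwards [coeFn_mulL oneSub continuousOn_oneSub f, h.ae_eq_primitive] with x h1 h2
    rw [h1, h2]; rfl)
  have e := h.oneSub_mul.green h
  rw [hev.1, hev.2, inner_sub_left, inner_mulL_comm, real_inner_self_eq_norm_sq,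
    real_inner_comm _ g] at e
  simp only [oneSub, Pi.mul_apply, sub_zero, sub_self, zero_mul, one_mul,
    intervalIntegral.integral_same, add_zero] at e
  linarith

/-! ### Mild and strong solutions of abstract evolution equations -/

section Abstract

variable {E : Type*} [NormedAddCommGroup E] [NormedSpace ℝ E]

/-- The average of `F` over `[t, t + h]`. -/
def avg (h : ℝ) (F : ℝ → E) (t : ℝ) : E := h⁻¹ • ∫ s in t..t + h, F s

/-- The forward difference quotient of `F` with step `h`; it is the derivative of `avg h F`. -/
def dq (h : ℝ) (F : ℝ → E) (t : ℝ) : E := h⁻¹ • (F (t + h) - F t)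

/-- `F` is a mild solution for `t ≥ 0` of the evolution equation whose generator has graph `G`.
For convenience `F` is defined and continuous on the whole line. -/
def IsMild (G : Submodule ℝ (E × E)) (F : ℝ → E) : Prop :=
  Continuous F ∧ ∀ t s, 0 ≤ t → t ≤ s → (∫ r in t..s, F r, F s - F t) ∈ G

/-- `X` is a strong solution for `t ≥ 0`, with continuous derivative `Y`, of the evolution equation
whose generator has graph `G`. -/
def IsStrong (G : Submodule ℝ (E × E)) (X Y : ℝ → E) : Prop :=
  (∀ t, HasDerivAt X (Y t) t) ∧ Continuous Y ∧ ∀ t, 0 ≤ t → (X t, Y t) ∈ G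

theorem IsStrong.continuous {G : Submodule ℝ (E × E)} {X Y : ℝ → E} (h : IsStrong G X Y) :
    Continuous X := continuous_iff_continuousAt.2 fun t => (h.1 t).continuousAt

theorem IsStrong.dq {G : Submodule ℝ (E × E)} {X Y : ℝ → E} (h : IsStrong G X Y) {δ : ℝ}
    (hδ : 0 < δ) : IsStrong G (dq δ X) (dq δ Y) := by
  refine ⟨fun t => ?_, ?_, fun t ht => ?_⟩
  · exact (((h.1 (t + δ)).comp_add_const t δ).sub (h.1 t)).const_smul δ⁻¹
  · have := h.2.1
    unfold Crane.dq
    fun_prop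
  · exact G.smul_mem δ⁻¹ (G.sub_mem (h.2.2 (t + δ) (by linarith)) (h.2.2 t ht))

theorem IsMild.sub {G : Submodule ℝ (E × E)} {F F' : ℝ → E} (h : IsMild G F) (h' : IsMild G F') :
    IsMild G (F - F') := by
  refine ⟨h.1.sub h'.1, fun t s ht hts => ?_⟩
  have e := G.sub_mem (h.2 t s ht hts) (h'.2 t s ht hts)
  rw [Prod.mk_sub_mk, ← intervalIntegral.integral_sub (h.1.intervalIntegrable _ _)
    (h'.1.intervalIntegrable _ _)] at e
  have e2 : (F - F') s - (F - F') t = F s - F t - (F' s - F' t) := by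
    simp only [Pi.sub_apply]; abel
  rw [e2]
  exact e

theorem intervalIntegral_mem_of_isClosed [CompleteSpace E] {G : Submodule ℝ E}
    (hG : IsClosed (G : Set E)) {F : ℝ → E} (hF : Continuous F) {a b : ℝ} (hab : a ≤ b)
    (h : ∀ t ∈ Icc a b, F t ∈ G) : ∫ t in a..b, F t ∈ G := by
  have : IsClosed (G : Set E) := hG
  rw [← Submodule.Quotient.mk_eq_zero, ← Submodule.mkQ_apply]
  have e := (G.mkQL).intervalIntegral_comp_comm (hF.intervalIntegrable (μ := volume) a b)
  refine Eq.trans e.symm ?_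
  refine (intervalIntegral.integral_congr (g := fun _ => (0 : E ⧸ G)) fun t ht => ?_).trans
    (by simp)
  rw [uIcc_of_le hab] at ht
  exact (Submodule.Quotient.mk_eq_zero G).2 (h t ht)

variable [CompleteSpace E] {G : Submodule ℝ (E × E)}

theorem hasDerivAt_avg {F : ℝ → E} (hF : Continuous F) (h t : ℝ) :
    HasDerivAt (avg h F) (dq h F t) t := by
  have e : avg h F = fun t => h⁻¹ • ((∫ s in (0 : ℝ)..t + h, F s) - ∫ s in (0 : ℝ)..t, F s) := by
    funext t
    rw [avg, intervalIntegral.integral_interval_sub_left (hF.intervalIntegrable _ _)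
      (hF.intervalIntegrable _ _)]
  have hd : ∀ t, HasDerivAt (fun t => ∫ s in (0 : ℝ)..t, F s) (F t) t := fun t =>
    intervalIntegral.integral_hasDerivAt_right (hF.intervalIntegrable _ _)
      (hF.stronglyMeasurableAtFilter _ _) hF.continuousAt
  rw [e]
  exact (((hd (t + h)).comp_add_const t h).sub (hd t)).const_smul h⁻¹

theorem IsMild.strong_avg {F : ℝ → E} (hF : IsMild G F) {h : ℝ} (hh : 0 < h) :
    IsStrong G (avg h F) (dq h F) := by
  refine ⟨hasDerivAt_avg hF.1 h, ?_, fun t ht => ?_⟩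
  · have := hF.1
    unfold dq
    fun_prop
  · exact G.smul_mem h⁻¹ (hF.2 t (t + h) ht (by linarith))

theorem IsStrong.mild (hG : IsClosed (G : Set (E × E))) {X Y : ℝ → E} (h : IsStrong G X Y) :
    IsMild G X := by
  have hX := h.continuous
  refine ⟨hX, fun t s ht hts => ?_⟩
  have hY : ∫ r in t..s, Y r = X s - X t :=
    intervalIntegral.integral_eq_sub_of_hasDerivAt (fun r _ => h.1 r)
      (h.2.1.intervalIntegrable _ _)
  have hp : ∫ r in t..s, (X r, Y r) = (∫ r in t..s, X r, ∫ r in t..s, Y r) := by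
    have hi : IntervalIntegrable (fun r => (X r, Y r)) volume t s :=
      (hX.prodMk h.2.1).intervalIntegrable _ _
    refine Prod.ext ?_ ?_
    · exact ((ContinuousLinearMap.fst ℝ E E).intervalIntegral_comp_comm hi).symm
    · exact ((ContinuousLinearMap.snd ℝ E E).intervalIntegral_comp_comm hi).symm
  rw [← hY, ← hp]
  exact intervalIntegral_mem_of_isClosed hG (hX.prodMk h.2.1) hts
    fun r hr => h.2.2 r (ht.trans hr.1)

theorem tendsto_avg {F : ℝ → E} (hF : Continuous F) (t : ℝ) :
    Tendsto (fun h => avg h F t) (𝓝[>] 0) (𝓝 (F t)) := by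
  have hd : HasDerivAt (fun u => ∫ s in t..u, F s) (F t) t :=
    intervalIntegral.integral_hasDerivAt_right (hF.intervalIntegrable _ _)
      (hF.stronglyMeasurableAtFilter _ _) hF.continuousAt
  have h0 := hd.tendsto_slope_zero
  simp only [intervalIntegral.integral_same, sub_zero] at h0
  exact h0.mono_left (nhdsWithin_mono _ fun x hx => ne_of_gt hx)

/-- A continuous functional that does not increase along strong solutions does not increase along
mild solutions, which are limits of their averages. -/
theorem IsMild.le_of_strong {V : E → ℝ} (hV : Continuous V)
    (hdec : ∀ X Y, IsStrong G X Y → ∀ t, 0 ≤ t → V (X t) ≤ V (X 0)) {F : ℝ → E}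
    (hF : IsMild G F) {t : ℝ} (ht : 0 ≤ t) : V (F t) ≤ V (F 0) := by
  refine le_of_tendsto_of_tendsto ((hV.tendsto _).comp (tendsto_avg hF.1 t))
    ((hV.tendsto _).comp (tendsto_avg hF.1 0)) ?_
  filter_upwards [self_mem_nhdsWithin] with h hh
  exact hdec _ _ (hF.strong_avg hh) t ht

/-- If `V` does not increase along solutions, decay of `V` along all averages of a mild solution
implies decay along the solution itself. -/
theorem IsMild.tendsto_of_avg (hG : IsClosed (G : Set (E × E))) {V : E → ℝ} (hV : Continuous V)
    (hV0 : V 0 = 0) (hVnn : ∀ x, 0 ≤ V x) (hVadd : ∀ x y, V (x + y) ≤ 2 * V x + 2 * V y)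
    (hdec : ∀ X Y, IsStrong G X Y → ∀ t, 0 ≤ t → V (X t) ≤ V (X 0)) {F : ℝ → E}
    (hF : IsMild G F)
    (h : ∀ δ, 0 < δ → Tendsto (fun t => V (avg δ F t)) atTop (𝓝 0)) :
    Tendsto (fun t => V (F t)) atTop (𝓝 0) := by
  have hlim : Tendsto (fun δ => V (F 0 - avg δ F 0)) (𝓝[>] 0) (𝓝 0) := by
    have := (hV.tendsto _).comp ((tendsto_const_nhds (x := F 0)).sub (tendsto_avg hF.1 0))
    rwa [sub_self, hV0] at this
  rw [Metric.tendsto_nhds]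
  intro ε hε
  obtain ⟨δ, hδ, hδ0⟩ := ((hlim.eventually (gt_mem_nhds (show 0 < ε / 4 by positivity))).and
    self_mem_nhdsWithin).exists
  filter_upwards [(h δ hδ0).eventually (gt_mem_nhds (show 0 < ε / 4 by positivity)),
    eventually_ge_atTop 0] with t h1 ht
  rw [Real.dist_0_eq_abs, abs_of_nonneg (hVnn _)]
  have h2 := (hF.sub ((hF.strong_avg hδ0).mild hG)).le_of_strong hV hdec ht
  simp only [Pi.sub_apply] at h2
  have h3 := hVadd (F t - avg δ F t) (avg δ F t)
  rw [sub_add_cancel] at h3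
  linarith

/-- To prove decay of `V` along mild solutions it suffices to treat solutions that are three times
differentiable in time with all derivatives being solutions. -/
theorem IsMild.tendsto_of_smooth (hG : IsClosed (G : Set (E × E))) {V : E → ℝ} (hV : Continuous V)
    (hV0 : V 0 = 0) (hVnn : ∀ x, 0 ≤ V x) (hVadd : ∀ x y, V (x + y) ≤ 2 * V x + 2 * V y)
    (hdec : ∀ X Y, IsStrong G X Y → ∀ t, 0 ≤ t → V (X t) ≤ V (X 0))
    (hsm : ∀ X₀ X₁ X₂ X₃, IsStrong G X₀ X₁ → IsStrong G X₁ X₂ → IsStrong G X₂ X₃ →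
      Tendsto (fun t => V (X₀ t)) atTop (𝓝 0)) {F : ℝ → E} (hF : IsMild G F) :
    Tendsto (fun t => V (F t)) atTop (𝓝 0) := by
  refine hF.tendsto_of_avg hG hV hV0 hVnn hVadd hdec fun a ha => ?_
  have h1 := hF.strong_avg ha
  refine (h1.mild hG).tendsto_of_avg hG hV hV0 hVnn hVadd hdec fun b hb => ?_
  have h2 := (h1.mild hG).strong_avg hb
  refine (h2.mild hG).tendsto_of_avg hG hV hV0 hVnn hVadd hdec fun c hc => ?_
  have h3 := (h2.mild hG).strong_avg hc
  exact hsm _ _ _ _ h3 (h2.dq hc) ((h1.dq hb).dq hc)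

end Abstract

/-! ### The graph of the crane operator as a closed subspace -/

/-- The pairs `(f, g)` in `L²(0,1)` in which `g` is the weak derivative of `f`. -/
def weakPairs : Submodule ℝ (L2 × L2) :=
  sobolev.comap (WithLp.prodContinuousLinearEquiv 2 ℝ L2 L2).symm.toLinearMap

theorem isClosed_weakPairs : IsClosed (weakPairs : Set (L2 × L2)) :=
  isClosed_sobolev.preimage (WithLp.prodContinuousLinearEquiv 2 ℝ L2 L2).symm.continuous

/-- The embedding of `H¹(0,1)` into `L²(0,1) × L²(0,1)`. -/
def pairL : H1 →L[ℝ] L2 × L2 :=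
  (WithLp.prodContinuousLinearEquiv 2 ℝ L2 L2).toContinuousLinearMap.comp sobolev.subtypeL

theorem H1.isWeakDeriv (y : H1) : IsWeakDeriv y.fn y.dx := y.2

/-- The coordinate `(y, y_x)` of a state. -/
def yL : State →L[ℝ] L2 × L2 := pairL.comp (.fst ℝ H1 (L2 × L2 × ℝ × ℝ))

/-- The coordinate `z` of a state. -/
def zL : State →L[ℝ] L2 := (ContinuousLinearMap.fst ℝ L2 (L2 × ℝ × ℝ)).comp (.snd ℝ H1 _)

/-- The coordinate `u` of a state. -/
def uL : State →L[ℝ] L2 :=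
  ((ContinuousLinearMap.fst ℝ L2 (ℝ × ℝ)).comp (.snd ℝ L2 _)).comp (.snd ℝ H1 _)

/-- The coordinate `ξ` of a state. -/
def xiL : State →L[ℝ] ℝ :=
  (((ContinuousLinearMap.fst ℝ ℝ ℝ).comp (.snd ℝ L2 _)).comp (.snd ℝ L2 _)).comp (.snd ℝ H1 _)

/-- The coordinate `η` of a state. -/
def etaL : State →L[ℝ] ℝ :=
  (((ContinuousLinearMap.snd ℝ ℝ ℝ).comp (.snd ℝ L2 _)).comp (.snd ℝ L2 _)).comp (.snd ℝ H1 _)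

/-- The coordinate `y_x` of a state. -/
def dxL : State →L[ℝ] L2 := (ContinuousLinearMap.snd ℝ L2 L2).comp yL

theorem yL_eq (Φ : State) : yL Φ = ((State.y Φ).fn, dxL Φ) := rfl

variable (p : Params) (hac : ContinuousOn p.a (Icc 0 1))

/-- For `Ψ = 𝓐 Φ`, the pair `(u, u_x)`, with `u_x` recovered from the transport equation. -/
def Params.uPair : State × State →L[ℝ] L2 × L2 :=
  (uL.comp (.fst ℝ State State)).prod (-p.τ • uL.comp (.snd ℝ State State))

/-- For `Ψ = 𝓐 Φ`, the pair `(a y_x, (a y_x)_x)`, with `(a y_x)_x` recovered from the wave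
equation. -/
def Params.fluxPair : State × State →L[ℝ] L2 × L2 :=
  (((mulL p.a hac).comp dxL).comp (.fst ℝ State State)).prod
    (zL.comp (.snd ℝ State State) + p.σ • zL.comp (.fst ℝ State State))

/-- The equations of the system, other than the regularity of `u` and of `a y_x`, as the vanishing
of a continuous linear map of `(Φ, Ψ)`. -/
def Params.equations : State × State →L[ℝ] L2 × ℝ × ℝ × ℝ × ℝ × ℝ :=
  let Φ := ContinuousLinearMap.fst ℝ State State
  let Ψ := ContinuousLinearMap.snd ℝ State State
  ((ContinuousLinearMap.fst ℝ L2 L2).comp (yL.comp Ψ) - zL.comp Φ).prod <|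
    (ev0.comp p.uPair - xiL.comp Φ).prod <|
    (ev0.comp (yL.comp Ψ) - xiL.comp Φ).prod <|
    (ev1.comp (yL.comp Ψ) - etaL.comp Φ).prod <|
    (p.m • xiL.comp Ψ - (ev0.comp (p.fluxPair hac) - p.β • xiL.comp Φ
      + p.α • ev1.comp p.uPair)).prod (p.M • etaL.comp Ψ + ev1.comp (p.fluxPair hac))

/-- A closed subspace of `𝓗 × 𝓗` containing the graph of `𝓐`: the pairs `(Φ, Ψ)` satisfying the
equations `Ψ = 𝓐 Φ` in which all traces are replaced by their expressions as continuous
functionals. -/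
def Params.graph : Submodule ℝ (State × State) :=
  weakPairs.comap p.uPair.toLinearMap ⊓ weakPairs.comap (p.fluxPair hac).toLinearMap ⊓
    (p.equations hac).ker

theorem Params.isClosed_graph : IsClosed (p.graph hac : Set (State × State)) :=
  ((isClosed_weakPairs.preimage p.uPair.continuous).inter
    (isClosed_weakPairs.preimage (p.fluxPair hac).continuous)).inter
    (p.equations hac).isClosed_ker

theorem Params.mem_graph {Φ Ψ : State} : (Φ, Ψ) ∈ p.graph hac ↔
    IsWeakDeriv (uL Φ) (-p.τ • uL Ψ : L2) ∧
    IsWeakDeriv (mulL p.a hac (dxL Φ)) (zL Ψ + p.σ • zL Φ : L2) ∧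
    (State.y Ψ).fn = zL Φ ∧
    ev0 (uL Φ, -p.τ • uL Ψ) = xiL Φ ∧
    ev0 (yL Ψ) = xiL Φ ∧ ev1 (yL Ψ) = etaL Φ ∧
    p.m * xiL Ψ = ev0 (mulL p.a hac (dxL Φ), zL Ψ + p.σ • zL Φ) - p.β * xiL Φ
      + p.α * ev1 (uL Φ, -p.τ • uL Ψ) ∧
    p.M * etaL Ψ = -ev1 (mulL p.a hac (dxL Φ), zL Ψ + p.σ • zL Φ) := by
  have e : (Φ, Ψ) ∈ (p.equations hac).ker ↔
      (State.y Ψ).fn - zL Φ = 0 ∧ ev0 (uL Φ, -p.τ • uL Ψ) - xiL Φ = 0 ∧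
      ev0 (yL Ψ) - xiL Φ = 0 ∧ ev1 (yL Ψ) - etaL Φ = 0 ∧
      p.m * xiL Ψ - (ev0 (mulL p.a hac (dxL Φ), zL Ψ + p.σ • zL Φ) - p.β * xiL Φ
        + p.α * ev1 (uL Φ, -p.τ • uL Ψ)) = 0 ∧
      p.M * etaL Ψ + ev1 (mulL p.a hac (dxL Φ), zL Ψ + p.σ • zL Φ) = 0 := by
    rw [LinearMap.mem_ker]
    simp only [← Prod.mk_eq_zero]
    rfl
  simp only [sub_eq_zero, add_eq_zero_iff_eq_neg] at e
  rw [Params.graph, Submodule.mem_inf, Submodule.mem_inf, e, and_assoc]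
  rfl

theorem Params.Graph.mem_graph {p : Params} (hac : ContinuousOn p.a (Icc 0 1)) (hτ : p.τ ≠ 0)
    (hm : p.m ≠ 0) (hM : p.M ≠ 0) {Φ Ψ : State} (h : p.Graph Φ Ψ) : (Φ, Ψ) ∈ p.graph hac := by
  obtain ⟨⟨-, -, -, hu0, hz0, hz1⟩, hy, ⟨w, hw, hzw⟩, ⟨v, hv, huv⟩, hξ, hη⟩ := h
  have ev : (-p.τ • uL Ψ : L2) = v := by
    show -p.τ • State.u Ψ = v
    rw [huv, smul_smul]
    convert one_smul ℝ v using 2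
    field_simp
  have ew : (zL Ψ + p.σ • zL Φ : L2) = w := by
    show State.z Ψ + p.σ • State.z Φ = w
    rw [hzw, sub_add_cancel]
  have hflux : p.flux (State.y Φ) =ᵐ[mu] mulL p.a hac (dxL Φ) := (coeFn_mulL _ hac _).symm
  have hw' : IsWeakDeriv (mulL p.a hac (dxL Φ)) w := hw.congr hflux (EventuallyEq.refl _ _)
  have hF := hw'.contRep_eq hflux
  have hU := IsWeakDeriv.contRep_eq (f := uL Φ) hv (EventuallyEq.refl _ _)
  have hZ := (State.y Ψ).isWeakDeriv.contRep_eq (EventuallyEq.refl _ _)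
  rw [hy] at hZ
  rw [Params.mem_graph, ev, ew]
  refine ⟨hv, hw', hy, ?_, ?_, ?_, ?_, ?_⟩
  · exact hU.1.symm.trans hu0.symm
  · rw [yL_eq, hy]; exact hZ.1.symm.trans hz0.symm
  · rw [yL_eq, hy]; exact hZ.2.symm.trans hz1.symm
  · show p.m * State.ξ Ψ = _
    rw [hξ, ← hF.1, ← hU.2]
    field_simp
    rfl
  · show p.M * State.η Ψ = _
    rw [hη, ← hF.2]
    field_simp

/-! ### The energy and its dissipation -/

/-- The bilinear form of the energy (the inner product of `𝓗` with `ϖ = 0`). -/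
def Params.energyB (K : ℝ) (Φ Ψ : State) : ℝ :=
  inner ℝ (mulL p.a hac (dxL Φ)) (dxL Ψ) + inner ℝ (zL Φ) (zL Ψ)
    + K * p.τ * inner ℝ (uL Φ) (uL Ψ) + p.m * (xiL Φ * xiL Ψ) + p.M * (etaL Φ * etaL Ψ)

/-- The energy `∫₀¹ (a y_x² + z²) + K τ ∫₀¹ u² + m ξ² + M η²`. -/
def Params.energy (K : ℝ) (Φ : State) : ℝ := p.energyB hac K Φ Φ

/-- The quantities dissipated by the system, for `Ψ = 𝓐 Φ`: `‖z‖² + ξ² + u(1)²`. -/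
def Params.dissip (Φ Ψ : State) : ℝ :=
  ‖zL Φ‖ ^ 2 + xiL Φ ^ 2 + ev1 (uL Φ, -p.τ • uL Ψ) ^ 2

variable {p hac}

theorem Params.continuous_energy (K : ℝ) : Continuous (p.energy hac K) := by
  unfold Params.energy Params.energyB
  fun_prop

theorem Params.energy_eq (K : ℝ) (Φ : State) : p.energy hac K Φ =
    inner ℝ (mulL p.a hac (dxL Φ)) (dxL Φ) + ‖zL Φ‖ ^ 2 + K * p.τ * ‖uL Φ‖ ^ 2
      + p.m * xiL Φ ^ 2 + p.M * etaL Φ ^ 2 := by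
  simp only [Params.energy, Params.energyB, real_inner_self_eq_norm_sq]
  ring

theorem Params.energy_zero (K : ℝ) : p.energy hac K 0 = 0 := by simp [Params.energy_eq]

theorem Params.energy_lower {K a₀ : ℝ} (ha : ∀ x ∈ Icc (0 : ℝ) 1, a₀ ≤ p.a x) (Φ : State) :
    a₀ * ‖dxL Φ‖ ^ 2 + ‖zL Φ‖ ^ 2 + K * p.τ * ‖uL Φ‖ ^ 2
      + p.m * xiL Φ ^ 2 + p.M * etaL Φ ^ 2 ≤ p.energy hac K Φ := by
  rw [Params.energy_eq]
  linarith [le_inner_mulL hac ha (dxL Φ)]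

theorem Params.energy_add_le {K : ℝ} (hnn : ∀ Φ, 0 ≤ p.energy hac K Φ) (Φ Ψ : State) :
    p.energy hac K (Φ + Ψ) ≤ 2 * p.energy hac K Φ + 2 * p.energy hac K Ψ := by
  have e : p.energy hac K (Φ + Ψ) + p.energy hac K (Φ - Ψ)
      = 2 * p.energy hac K Φ + 2 * p.energy hac K Ψ := by
    simp only [Params.energy, Params.energyB, map_add, map_sub, inner_add_left, inner_add_right,
      inner_sub_left, inner_sub_right]
    ring
  linarith [hnn (Φ - Ψ)]

theorem Params.hasDerivAt_energy (K : ℝ) {X Y : ℝ → State} {t : ℝ} (h : HasDerivAt X (Y t) t) :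
    HasDerivAt (fun t => p.energy hac K (X t)) (2 * p.energyB hac K (X t) (Y t)) t := by
  have hL : ∀ {F : Type} [NormedAddCommGroup F] [NormedSpace ℝ F] (T : State →L[ℝ] F),
      HasDerivAt (fun t => T (X t)) (T (Y t)) t := fun T => T.hasFDerivAt.comp_hasDerivAt t h
  have h1 := ((hL ((mulL p.a hac).comp dxL)).inner ℝ (hL dxL)).add
    ((hL zL).inner ℝ (hL zL))
  have h2 := (h1.add (((hL uL).inner ℝ (hL uL)).const_mul (K * p.τ))).add
    (((hL xiL).mul (hL xiL)).const_mul p.m)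
  have h3 := h2.add (((hL etaL).mul (hL etaL)).const_mul p.M)
  refine h3.congr_deriv ?_
  simp only [Params.energyB, ContinuousLinearMap.comp_apply]
  rw [inner_mulL_comm p.a hac (dxL (Y t)), real_inner_comm (mulL p.a hac (dxL (X t))) (dxL (Y t)),
    real_inner_comm (zL (X t)) (zL (Y t)), real_inner_comm (uL (X t)) (uL (Y t))]
  ring

/-- The energy identity. -/
theorem Params.energyB_eq (K : ℝ) {Φ Ψ : State} (h : (Φ, Ψ) ∈ p.graph hac) :
    p.energyB hac K Φ Ψ = -p.σ * ‖zL Φ‖ ^ 2 - K / 2 * ev1 (uL Φ, -p.τ • uL Ψ) ^ 2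
      + (K / 2 - p.β) * xiL Φ ^ 2 + p.α * xiL Φ * ev1 (uL Φ, -p.τ • uL Ψ) := by
  obtain ⟨hu, hw, hy, hu0, hz0, hz1, hξ, hη⟩ := p.mem_graph hac |>.1 h
  have g1 := hw.green (State.y Ψ).isWeakDeriv
  have g2 := hu.green hu
  have ey : yL Ψ = ((State.y Ψ).fn, (State.y Ψ).dx) := rfl
  rw [← ey, hz0, hz1, hy, inner_add_left, real_inner_smul_left, real_inner_self_eq_norm_sq] at g1
  rw [hu0, real_inner_smul_left, real_inner_smul_right, real_inner_comm (uL Φ) (uL Ψ)] at g2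
  have e1 : p.m * (xiL Φ * xiL Ψ) = xiL Φ * (p.m * xiL Ψ) := by ring
  have e2 : p.M * (etaL Φ * etaL Ψ) = etaL Φ * (p.M * etaL Ψ) := by ring
  rw [Params.energyB, e1, e2, hξ, hη, real_inner_comm (zL Ψ) (zL Φ)]
  have e3 : dxL Ψ = (State.y Ψ).dx := rfl
  rw [e3]
  linear_combination g1 - K / 2 * g2

theorem Params.exists_energyB_le {K : ℝ} (hσ : 0 < p.σ) (hK₁ : |p.α| < K)
    (hK₂ : K < 2 * p.β - |p.α|) : ∃ c : ℝ, 0 < c ∧ ∀ Φ Ψ, (Φ, Ψ) ∈ p.graph hac →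
      p.energyB hac K Φ Ψ ≤ -c * p.dissip Φ Ψ := by
  obtain ⟨c, hc0, hc⟩ : ∃ c, 0 < c ∧ c ≤ min p.σ (min ((K - |p.α|) / 2) (p.β - (K + |p.α|) / 2)) :=
    ⟨_, lt_min hσ (lt_min (by linarith) (by linarith)), le_rfl⟩
  obtain ⟨c1, c2, c3⟩ : c ≤ p.σ ∧ c ≤ (K - |p.α|) / 2 ∧ c ≤ p.β - (K + |p.α|) / 2 :=
    ⟨hc.trans (min_le_left _ _), hc.trans ((min_le_right _ _).trans (min_le_left _ _)),
      hc.trans ((min_le_right _ _).trans (min_le_right _ _))⟩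
  refine ⟨c, hc0, fun Φ Ψ h => ?_⟩
  rw [Params.energyB_eq K h, Params.dissip]
  set x := xiL Φ
  set u := ev1 (uL Φ, -p.τ • uL Ψ)
  -- Young's inequality for the delayed term.
  have hy : p.α * x * u ≤ |p.α| / 2 * (x ^ 2 + u ^ 2) := by
    have h1 : p.α * x * u ≤ |p.α| * (|x| * |u|) := by
      rw [mul_assoc, ← abs_mul x u, ← abs_mul]; exact le_abs_self _
    have h2 : |x| * |u| ≤ (x ^ 2 + u ^ 2) / 2 := by
      rw [← sq_abs x, ← sq_abs u]; nlinarith [sq_nonneg (|x| - |u|)]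
    nlinarith [mul_le_mul_of_nonneg_left h2 (abs_nonneg p.α)]
  nlinarith [mul_le_mul_of_nonneg_right c1 (sq_nonneg ‖zL Φ‖),
    mul_le_mul_of_nonneg_right c2 (sq_nonneg u), mul_le_mul_of_nonneg_right c3 (sq_nonneg x)]

/-- The tension `a y_x` is controlled by the velocities and the accelerations, which are among the
dissipated quantities of the solution and of its time derivative. -/
theorem Params.exists_norm_dx_sq_le {a₀ : ℝ} (ha₀ : 0 < a₀)
    (ha : ∀ x ∈ Icc (0 : ℝ) 1, a₀ ≤ p.a x) : ∃ C : ℝ, 0 ≤ C ∧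
      ∀ Φ Ψ, (Φ, Ψ) ∈ p.graph hac →
        ‖dxL Φ‖ ^ 2 ≤ C * (p.dissip Φ Ψ + (‖zL Ψ‖ ^ 2 + xiL Ψ ^ 2)) := by
  set R := |p.m| + |p.β| + |p.α| + 1 + |p.σ| with hR
  have hR0 : 0 ≤ R := by positivity
  refine ⟨5 * R ^ 2 / a₀ ^ 2, by positivity, fun Φ Ψ h => ?_⟩
  obtain ⟨hu, hw, hy, hu0, hz0, hz1, hξ, hη⟩ := p.mem_graph hac |>.1 h
  rw [Params.dissip]
  set g := dxL Φ
  set f := mulL p.a hac g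
  set w : L2 := zL Ψ + p.σ • zL Φ with hwdef
  set F0 := ev0 (f, w)
  set u1 := ev1 (uL Φ, -p.τ • uL Ψ)
  have h1 : a₀ * ‖g‖ ≤ ‖f‖ := by
    have e1 := le_inner_mulL hac ha g
    have e2 : inner ℝ f g ≤ ‖f‖ * ‖g‖ := real_inner_le_norm _ _
    by_contra hcon
    push Not at hcon
    have hg : 0 < ‖g‖ := by
      by_contra h0
      nlinarith [norm_nonneg g, norm_nonneg f]
    nlinarith
  have h2 : ‖f‖ ≤ ‖w‖ + |F0| := by
    calc ‖f‖ = ‖(f - F0 • one) + F0 • one‖ := by rw [sub_add_cancel]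
      _ ≤ ‖f - F0 • one‖ + ‖F0 • one‖ := norm_add_le _ _
      _ ≤ ‖w‖ + |F0| := by
        rw [norm_smul, norm_one_L2, mul_one, Real.norm_eq_abs]
        exact add_le_add_left hw.norm_sub_le _
  have h3 : ‖w‖ ≤ ‖zL Ψ‖ + |p.σ| * ‖zL Φ‖ := by
    refine (norm_add_le _ _).trans_eq ?_
    rw [norm_smul, Real.norm_eq_abs]
  have h4 : |F0| ≤ |p.m| * |xiL Ψ| + |p.β| * |xiL Φ| + |p.α| * |u1| := by
    have e : F0 = p.m * xiL Ψ + p.β * xiL Φ - p.α * u1 := by linarith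
    rw [e, ← abs_mul, ← abs_mul, ← abs_mul]
    exact (abs_sub _ _).trans (add_le_add_left (abs_add_le _ _) _)
  have hr : ∀ {c s : ℝ}, c ≤ R → 0 ≤ s → c * s ≤ R * s := fun hc hs =>
    mul_le_mul_of_nonneg_right hc hs
  have p1 := abs_nonneg p.m
  have p2 := abs_nonneg p.β
  have p3 := abs_nonneg p.α
  have p4 := abs_nonneg p.σ
  have h5 : a₀ * ‖g‖ ≤ R * (‖zL Ψ‖ + ‖zL Φ‖ + |xiL Ψ| + |xiL Φ| + |u1|) := by
    have k1 := hr (show (1 : ℝ) ≤ R by linarith) (norm_nonneg (zL Ψ))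
    have k2 := hr (show |p.σ| ≤ R by linarith) (norm_nonneg (zL Φ))
    have k3 := hr (show |p.m| ≤ R by linarith) (abs_nonneg (xiL Ψ))
    have k4 := hr (show |p.β| ≤ R by linarith) (abs_nonneg (xiL Φ))
    have k5 := hr (show |p.α| ≤ R by linarith) (abs_nonneg u1)
    linarith
  -- The Cauchy-Schwarz inequality for five summands.
  have h6 : (‖zL Ψ‖ + ‖zL Φ‖ + |xiL Ψ| + |xiL Φ| + |u1|) ^ 2
      ≤ 5 * (‖zL Φ‖ ^ 2 + xiL Φ ^ 2 + u1 ^ 2 + (‖zL Ψ‖ ^ 2 + xiL Ψ ^ 2)) := by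
    have e := Finset.sum_mul_sq_le_sq_mul_sq Finset.univ (fun _ : Fin 5 => (1 : ℝ))
      ![‖zL Ψ‖, ‖zL Φ‖, |xiL Ψ|, |xiL Φ|, |u1|]
    simp [Fin.sum_univ_five] at e
    linarith
  have h7 : (a₀ * ‖g‖) ^ 2 ≤ R ^ 2 * (5 * (‖zL Φ‖ ^ 2 + xiL Φ ^ 2 + u1 ^ 2
      + (‖zL Ψ‖ ^ 2 + xiL Ψ ^ 2))) := by
    refine (pow_le_pow_left₀ (by positivity) h5 2).trans ?_
    rw [mul_pow]
    exact mul_le_mul_of_nonneg_left h6 (sq_nonneg R)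
  rw [div_mul_eq_mul_div, le_div_iff₀ (by positivity)]
  linarith

theorem Params.eta_sq_le {Φ Ψ : State} (h : (Φ, Ψ) ∈ p.graph hac) :
    etaL Φ ^ 2 ≤ 2 * xiL Φ ^ 2 + 2 * ‖dxL Ψ‖ ^ 2 := by
  obtain ⟨-, -, -, -, hz0, hz1, -, -⟩ := p.mem_graph hac |>.1 h
  have h1 := abs_ev1_sub_ev0_le (State.y Ψ).fn (dxL Ψ)
  rw [← yL_eq, hz0, hz1] at h1
  have h2 := sq_le_sq' (abs_le.1 h1).1 (abs_le.1 h1).2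
  nlinarith [sq_nonneg (etaL Φ - 2 * xiL Φ)]

/-! ### Decay of the energy -/

theorem antitoneOn_of_hasDerivAt_nonpos {f f' : ℝ → ℝ} (h : ∀ t, HasDerivAt f (f' t) t)
    (h' : ∀ t, 0 ≤ t → f' t ≤ 0) : AntitoneOn f (Ici 0) := by
  refine antitoneOn_of_deriv_nonpos (convex_Ici 0)
    (fun t _ => (h t).continuousAt.continuousWithinAt)
    (fun t _ => (h t).differentiableAt.differentiableWithinAt) fun t ht => ?_
  rw [(h t).deriv]
  exact h' t (interior_subset ht)

theorem Params.dissip_nonneg (Φ Ψ : State) : 0 ≤ p.dissip Φ Ψ := by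
  unfold Params.dissip; positivity

theorem Params.energy_le_of_strong {K c : ℝ} (hc : 0 < c)
    (hdis : ∀ Φ Ψ, (Φ, Ψ) ∈ p.graph hac → p.energyB hac K Φ Ψ ≤ -c * p.dissip Φ Ψ)
    {X Y : ℝ → State} (h : IsStrong (p.graph hac) X Y) {t : ℝ} (ht : 0 ≤ t) :
    p.energy hac K (X t) ≤ p.energy hac K (X 0) := by
  refine antitoneOn_of_hasDerivAt_nonpos (fun t => Params.hasDerivAt_energy K (h.1 t))
    (fun t ht => ?_) self_mem_Ici ht ht
  nlinarith [hdis _ _ (h.2.2 t ht), p.dissip_nonneg (X t) (Y t)]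

/-- The weighted norm `τ ∫₀¹ (1 - x) u²` of the delay component. -/
def Params.delayWeight (p : Params) (Φ : State) : ℝ :=
  p.τ * inner ℝ (mulL oneSub continuousOn_oneSub (uL Φ)) (uL Φ)

theorem Params.delayWeight_nonneg (hτ : 0 < p.τ) (Φ : State) : 0 ≤ p.delayWeight Φ := by
  have := le_inner_mulL continuousOn_oneSub (c := 0)
    (fun x hx => by unfold oneSub; linarith [hx.2]) (uL Φ)
  rw [zero_mul] at this
  exact mul_nonneg hτ.le this

theorem Params.hasDerivAt_delayWeight {X Y : ℝ → State} (h : IsStrong (p.graph hac) X Y) {t : ℝ}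
    (ht : 0 ≤ t) : HasDerivAt (fun t => p.delayWeight (X t))
      (xiL (X t) ^ 2 - ‖uL (X t)‖ ^ 2) t := by
  have h1 : HasDerivAt (fun t => uL (X t)) (uL (Y t)) t :=
    uL.hasFDerivAt.comp_hasDerivAt t (h.1 t)
  have h2 : HasDerivAt (fun t => mulL oneSub continuousOn_oneSub (uL (X t)))
      (mulL oneSub continuousOn_oneSub (uL (Y t))) t :=
    (mulL oneSub continuousOn_oneSub).hasFDerivAt.comp_hasDerivAt t h1
  refine ((h2.inner ℝ h1).const_mul p.τ).congr_deriv ?_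
  obtain ⟨hu, -, -, hu0, -⟩ := p.mem_graph hac |>.1 (h.2.2 t ht)
  have e := hu.two_mul_inner_oneSub
  rw [hu0, real_inner_smul_right] at e
  rw [real_inner_comm (uL (X t)) (mulL oneSub continuousOn_oneSub (uL (Y t))), ← inner_mulL_comm]
  linarith

/-- The energy of a strong solution tends to zero if its first two time derivatives are strong
solutions as well. -/
theorem Params.tendsto_energy_of_smooth {K a₀ : ℝ} (hτ : 0 < p.τ) (hm : 0 < p.m) (hM : 0 < p.M)
    (hσ : 0 < p.σ) (ha₀ : 0 < a₀) (ha : ∀ x ∈ Icc (0 : ℝ) 1, a₀ ≤ p.a x) (hK₁ : |p.α| < K)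
    (hK₂ : K < 2 * p.β - |p.α|) (hnn : ∀ Φ, 0 ≤ p.energy hac K Φ) {X₀ X₁ X₂ X₃ : ℝ → State}
    (h₀ : IsStrong (p.graph hac) X₀ X₁) (h₁ : IsStrong (p.graph hac) X₁ X₂)
    (h₂ : IsStrong (p.graph hac) X₂ X₃) :
    Tendsto (fun t => p.energy hac K (X₀ t)) atTop (𝓝 0) := by
  obtain ⟨c, hc, hdis⟩ := Params.exists_energyB_le (hac := hac) hσ hK₁ hK₂
  obtain ⟨C, hC, hdx⟩ := Params.exists_norm_dx_sq_le (hac := hac) ha₀ ha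
  have hK : 0 < K := (abs_nonneg _).trans_lt hK₁
  set A := ‖mulL p.a hac‖
  set P := A * C + 1 + p.m + p.M * (2 + 2 * C) with hP
  have hA : 0 ≤ A := norm_nonneg _
  have hP0 : 0 ≤ P := by positivity
  -- The energy is bounded by the dissipated quantities of the three solutions and by `‖u‖²`.
  have hbound : ∀ t, 0 ≤ t → p.energy hac K (X₀ t) ≤ K * p.τ * ‖uL (X₀ t)‖ ^ 2
      + P * (p.dissip (X₀ t) (X₁ t) + p.dissip (X₁ t) (X₂ t) + p.dissip (X₂ t) (X₃ t)) := by
    intro t ht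
    have d0 := p.dissip_nonneg (X₀ t) (X₁ t)
    have d1 := p.dissip_nonneg (X₁ t) (X₂ t)
    have d2 := p.dissip_nonneg (X₂ t) (X₃ t)
    have hpart : ∀ Φ Ψ, ‖zL Φ‖ ^ 2 + xiL Φ ^ 2 ≤ p.dissip Φ Ψ := fun Φ Ψ => by
      unfold Params.dissip
      nlinarith [sq_nonneg (ev1 (uL Φ, -p.τ • uL Ψ))]
    have hp0 := hpart (X₀ t) (X₁ t)
    have b0 := hdx _ _ (h₀.2.2 t ht)
    have b1 := hdx _ _ (h₁.2.2 t ht)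
    have e0 := Params.eta_sq_le (h₀.2.2 t ht)
    have b0' : ‖dxL (X₀ t)‖ ^ 2 ≤ C * (p.dissip (X₀ t) (X₁ t) + p.dissip (X₁ t) (X₂ t)
        + p.dissip (X₂ t) (X₃ t)) :=
      b0.trans (mul_le_mul_of_nonneg_left (by linarith [hpart (X₁ t) (X₂ t)]) hC)
    have b1' : ‖dxL (X₁ t)‖ ^ 2 ≤ C * (p.dissip (X₀ t) (X₁ t) + p.dissip (X₁ t) (X₂ t)
        + p.dissip (X₂ t) (X₃ t)) :=
      b1.trans (mul_le_mul_of_nonneg_left (by linarith [hpart (X₂ t) (X₃ t)]) hC)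
    set D := p.dissip (X₀ t) (X₁ t) + p.dissip (X₁ t) (X₂ t) + p.dissip (X₂ t) (X₃ t)
    have hz : ‖zL (X₀ t)‖ ^ 2 ≤ D := by linarith [sq_nonneg (xiL (X₀ t))]
    have hx : xiL (X₀ t) ^ 2 ≤ D := by linarith [sq_nonneg ‖zL (X₀ t)‖]
    have hin : inner ℝ (mulL p.a hac (dxL (X₀ t))) (dxL (X₀ t)) ≤ A * (C * D) := by
      refine le_trans ?_ (mul_le_mul_of_nonneg_left b0' hA)
      refine (real_inner_le_norm _ _).trans ?_
      rw [sq, ← mul_assoc]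
      exact mul_le_mul_of_nonneg_right ((mulL p.a hac).le_opNorm _) (norm_nonneg _)
    have hη : p.M * etaL (X₀ t) ^ 2 ≤ p.M * (2 * D + 2 * (C * D)) :=
      mul_le_mul_of_nonneg_left (by linarith) hM.le
    have hmx := mul_le_mul_of_nonneg_left hx hm.le
    rw [Params.energy_eq, hP]
    linarith
  -- The Lyapunov function `(N / 2) (V₀ + V₁ + V₂) + K τ W` has derivative at most
  -- `-V₀`, where `W` is the weighted norm of the delay component.
  -- `N` is chosen so that the dissipation absorbs both `P D` and the growth `K τ ξ²` of `K τ W`.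
  set N := (P + K * p.τ) / c with hN
  have hN0 : 0 ≤ N := by positivity
  have hNc : N * c = P + K * p.τ := div_mul_cancel₀ _ hc.ne'
  let L : ℝ → ℝ := fun t => N / 2 * (p.energy hac K (X₀ t) + p.energy hac K (X₁ t)
    + p.energy hac K (X₂ t)) + K * p.τ * p.delayWeight (X₀ t)
  have hLnn : ∀ t, 0 ≤ L t := fun t => by
    have := hnn (X₀ t)
    have := hnn (X₁ t)
    have := hnn (X₂ t)
    have := p.delayWeight_nonneg hτ (X₀ t)
    positivity
  have hLd : ∀ t, 0 ≤ t → HasDerivAt L (N / 2 * (2 * p.energyB hac K (X₀ t) (X₁ t)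
      + 2 * p.energyB hac K (X₁ t) (X₂ t) + 2 * p.energyB hac K (X₂ t) (X₃ t))
      + K * p.τ * (xiL (X₀ t) ^ 2 - ‖uL (X₀ t)‖ ^ 2)) t := fun t ht =>
    ((((Params.hasDerivAt_energy K (h₀.1 t)).add (Params.hasDerivAt_energy K (h₁.1 t))).add
      (Params.hasDerivAt_energy K (h₂.1 t))).const_mul _).add
      ((Params.hasDerivAt_delayWeight h₀ ht).const_mul _)
  -- As `V₀` is nonincreasing, so is `L + t V₀`; this gives `t V₀(t) ≤ L(0)`.
  have hanti : AntitoneOn (fun t => L t + t * p.energy hac K (X₀ t)) (Ici 0) := by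
    have hd : ∀ t, 0 ≤ t → HasDerivAt (fun t => L t + t * p.energy hac K (X₀ t)) _ t :=
      fun t ht => (hLd t ht).add
        ((hasDerivAt_id t).mul (Params.hasDerivAt_energy (hac := hac) K (h₀.1 t)))
    refine antitoneOn_of_deriv_nonpos (convex_Ici 0)
      (fun t ht => (hd t ht).continuousAt.continuousWithinAt)
      (fun t ht => (hd t (interior_subset ht)).differentiableAt.differentiableWithinAt)
      fun t ht' => ?_
    have ht : 0 ≤ t := interior_subset ht'
    rw [(hd t ht).deriv]
    have i0 := hdis _ _ (h₀.2.2 t ht)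
    have i1 := hdis _ _ (h₁.2.2 t ht)
    have i2 := hdis _ _ (h₂.2.2 t ht)
    have d0 := p.dissip_nonneg (X₀ t) (X₁ t)
    have d1 := p.dissip_nonneg (X₁ t) (X₂ t)
    have d2 := p.dissip_nonneg (X₂ t) (X₃ t)
    have hb := hbound t ht
    have hx : xiL (X₀ t) ^ 2 ≤ p.dissip (X₀ t) (X₁ t) + p.dissip (X₁ t) (X₂ t)
        + p.dissip (X₂ t) (X₃ t) := by
      have : xiL (X₀ t) ^ 2 ≤ p.dissip (X₀ t) (X₁ t) := by
        unfold Params.dissip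
        nlinarith [sq_nonneg (ev1 (uL (X₀ t), -p.τ • uL (X₁ t))), sq_nonneg ‖zL (X₀ t)‖]
      linarith
    set D := p.dissip (X₀ t) (X₁ t) + p.dissip (X₁ t) (X₂ t) + p.dissip (X₂ t) (X₃ t) with hD
    have hN1 : N * (p.energyB hac K (X₀ t) (X₁ t) + p.energyB hac K (X₁ t) (X₂ t)
        + p.energyB hac K (X₂ t) (X₃ t)) ≤ -(P + K * p.τ) * D := by
      rw [← hNc]
      have := mul_le_mul_of_nonneg_left (add_le_add (add_le_add i0 i1) i2) hN0
      rw [hD]; linarith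
    have hx' := mul_le_mul_of_nonneg_left hx (show 0 ≤ K * p.τ by positivity)
    have hneg : t * (2 * p.energyB hac K (X₀ t) (X₁ t)) ≤ 0 := by
      refine mul_nonpos_of_nonneg_of_nonpos ht ?_
      nlinarith
    simp only [id]
    linarith
  have hle : ∀ᶠ t in atTop, p.energy hac K (X₀ t) ≤ L 0 / t := by
    filter_upwards [eventually_gt_atTop 0] with t ht
    have := hanti self_mem_Ici (show t ∈ Ici 0 from ht.le) ht.le
    simp only [zero_mul, add_zero] at this
    rw [le_div_iff₀ ht]
    linarith [hLnn t]
  exact squeeze_zero' (.of_forall fun t => hnn _) hle (tendsto_const_nhds.div_atTop tendsto_id)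

theorem Params.energy_nonneg {K : ℝ} (hτ : 0 < p.τ) (hm : 0 < p.m) (hM : 0 < p.M)
    {a₀ : ℝ} (ha₀ : 0 < a₀) (ha : ∀ x ∈ Icc (0 : ℝ) 1, a₀ ≤ p.a x) (hK : 0 < K) (Φ : State) :
    0 ≤ p.energy hac K Φ := by
  refine le_trans ?_ (Params.energy_lower ha Φ)
  positivity

theorem Params.tendsto_energy_of_mild {K a₀ : ℝ} (hτ : 0 < p.τ) (hm : 0 < p.m) (hM : 0 < p.M)
    (hσ : 0 < p.σ) (ha₀ : 0 < a₀) (ha : ∀ x ∈ Icc (0 : ℝ) 1, a₀ ≤ p.a x) (hK₁ : |p.α| < K)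
    (hK₂ : K < 2 * p.β - |p.α|) {F : ℝ → State} (hF : IsMild (p.graph hac) F) :
    Tendsto (fun t => p.energy hac K (F t)) atTop (𝓝 0) := by
  have hK : 0 < K := (abs_nonneg _).trans_lt hK₁
  have hnn := Params.energy_nonneg (hac := hac) hτ hm hM ha₀ ha hK
  obtain ⟨c, hc, hdis⟩ := Params.exists_energyB_le (hac := hac) hσ hK₁ hK₂
  exact hF.tendsto_of_smooth (p.isClosed_graph hac) (Params.continuous_energy K)
    (Params.energy_zero K) hnn (Params.energy_add_le hnn)
    (fun X Y h t ht => Params.energy_le_of_strong hc hdis h ht)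
    fun X₀ X₁ X₂ X₃ h₀ h₁ h₂ =>
      Params.tendsto_energy_of_smooth hτ hm hM hσ ha₀ ha hK₁ hK₂ hnn h₀ h₁ h₂

/-! ### The conserved functional and the limit state -/

/-- The functional `ℓ` as a continuous linear functional. -/
def Params.ellL (p : Params) : State →L[ℝ] ℝ :=
  p.σ • (innerSL ℝ one).comp ((ContinuousLinearMap.fst ℝ L2 L2).comp yL)
    + (innerSL ℝ one).comp zL + (p.α * p.τ) • (innerSL ℝ one).comp uL + p.m • xiL + p.M • etaL
    + (p.β - p.α) • ev0.comp yL

theorem Params.ellL_apply (Φ : State) : p.ellL Φ = p.σ * inner ℝ one (State.y Φ).fn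
    + inner ℝ one (zL Φ) + p.α * p.τ * inner ℝ one (uL Φ) + p.m * xiL Φ + p.M * etaL Φ
    + (p.β - p.α) * ev0 (yL Φ) := rfl

theorem Params.functional_eq (Φ : State) : p.functional Φ = p.ellL Φ := by
  have hi : ∀ f : L2, Integrable (fun x => f x) mu := fun f => (Lp.memLp f).integrable one_le_two
  have e0 : contRep (State.y Φ).fn 0 = ev0 (yL Φ) :=
    ((State.y Φ).isWeakDeriv.contRep_eq (EventuallyEq.refl _ _)).1
  have e1 : ∫ x in Ioo (0 : ℝ) 1,
      (p.σ * (State.y Φ).fn x + State.z Φ x + p.α * p.τ * State.u Φ x)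
      = p.σ * inner ℝ one (State.y Φ).fn + inner ℝ one (zL Φ)
        + p.α * p.τ * inner ℝ one (uL Φ) := by
    have h1 : Integrable (fun x => p.σ * (State.y Φ).fn x) mu := (hi _).const_mul _
    have h2 : Integrable (fun x => p.σ * (State.y Φ).fn x + State.z Φ x) mu := h1.add (hi _)
    rw [integral_add h2 ((hi _).const_mul _), integral_add h1 (hi _), integral_const_mul,
      integral_const_mul, inner_one, inner_one, inner_one, ← integral_Ioo_eq_intervalIntegral,
      ← integral_Ioo_eq_intervalIntegral, ← integral_Ioo_eq_intervalIntegral]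
    rfl
  rw [Params.functional, Params.ellL_apply, e0, e1]
  rfl

/-- The functional `ℓ` vanishes on the range of `𝓐`, hence is conserved by the evolution. -/
theorem Params.ellL_eq_zero {Φ Ψ : State} (h : (Φ, Ψ) ∈ p.graph hac) : p.ellL Ψ = 0 := by
  obtain ⟨hu, hw, hy, hu0, hz0, hz1, hξ, hη⟩ := p.mem_graph hac |>.1 h
  have g1 := ev1_sub_ev0 (mulL p.a hac (dxL Φ)) (zL Ψ + p.σ • zL Φ)
  have g2 := ev1_sub_ev0 (uL Φ) (-p.τ • uL Ψ)
  rw [inner_add_right, real_inner_smul_right] at g1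
  rw [hu0, real_inner_smul_right] at g2
  rw [Params.ellL_apply, hy, hz0, hξ, hη]
  linear_combination -g1 + p.α * g2

theorem Params.innerH_self_eq (K ϖ : ℝ) (Φ : State) :
    p.innerH K ϖ Φ Φ = p.energy hac K Φ + ϖ * p.ellL Φ * p.ellL Φ := by
  have e1 : ∫ x in Ioo (0 : ℝ) 1, p.a x * (State.y Φ).dx x * (State.y Φ).dx x
      + State.z Φ x * State.z Φ x
      = inner ℝ (mulL p.a hac (dxL Φ)) (dxL Φ) + inner ℝ (zL Φ) (zL Φ) := by
    have h1 : Integrable (fun x => p.a x * (State.y Φ).dx x * (State.y Φ).dx x) mu := by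
      refine ((Lp.memLp (mulL p.a hac (dxL Φ))).integrable_mul (Lp.memLp (dxL Φ))).congr ?_
      filter_upwards [coeFn_mulL p.a hac (dxL Φ)] with x hx
      rw [Pi.mul_apply, hx]
      rfl
    have h2 : Integrable (fun x => State.z Φ x * State.z Φ x) mu :=
      (Lp.memLp (zL Φ)).integrable_mul (Lp.memLp (zL Φ))
    rw [integral_add h1 h2, inner_mulL, L2_inner_eq, ← integral_Ioo_eq_intervalIntegral]
    rfl
  have e2 : ∫ x in Ioo (0 : ℝ) 1, State.u Φ x * State.u Φ x = inner ℝ (uL Φ) (uL Φ) := by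
    rw [L2_inner_eq, ← integral_Ioo_eq_intervalIntegral]
    rfl
  rw [Params.innerH, e1, e2, Params.functional_eq, Params.energy, Params.energyB]
  have e3 : State.ξ Φ = xiL Φ := rfl
  have e4 : State.η Φ = etaL Φ := rfl
  rw [e3, e4]
  ring

theorem tendsto_zero_of_mul_sq_le {E : Type*} [SeminormedAddCommGroup E] {c : ℝ} (hc : 0 < c)
    {f : ℝ → E} {V : ℝ → ℝ} (hV : Tendsto V atTop (𝓝 0)) (h : ∀ t, c * ‖f t‖ ^ 2 ≤ V t) :
    Tendsto f atTop (𝓝 0) := by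
  rw [tendsto_zero_iff_norm_tendsto_zero]
  have h1 : Tendsto (fun t => ‖f t‖ ^ 2) atTop (𝓝 0) := by
    refine squeeze_zero (fun t => sq_nonneg _) (fun t => ?_) (by simpa using hV.div_const c)
    rw [le_div_iff₀ hc]
    linarith [h t]
  have h2 := (Real.continuous_sqrt.tendsto 0).comp h1
  simpa [Function.comp_def, Real.sqrt_sq (norm_nonneg _)] using h2

theorem fn_const (c : ℝ) : (H1.const c).fn = c • one := by
  refine Lp.ext ?_
  have h : (H1.const c).fn =ᵐ[mu] fun _ => c := MemLp.coeFn_toLp (memLp_const c)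
  filter_upwards [h, Lp.coeFn_smul c one, coeFn_one] with x h1 h2 h3
  rw [h1, h2, Pi.smul_apply, h3, smul_eq_mul, mul_one]

/-- A family of states whose energy tends to zero and on which `ℓ` is constant converges to an
equilibrium. -/
theorem Params.tendsto_equilibrium {K a₀ ℓ₀ : ℝ} (hτ : 0 < p.τ) (hm : 0 < p.m) (hM : 0 < p.M)
    (ha₀ : 0 < a₀) (ha : ∀ x ∈ Icc (0 : ℝ) 1, a₀ ≤ p.a x) (hK : 0 < K)
    (hs : p.σ + p.β - p.α ≠ 0) {F : ℝ → State}
    (hV : Tendsto (fun t => p.energy hac K (F t)) atTop (𝓝 0))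
    (hℓ : ∀ᶠ t in atTop, p.ellL (F t) = ℓ₀) :
    Tendsto F atTop (𝓝 (equilibrium (ℓ₀ / (p.σ + p.β - p.α)))) := by
  have hlow := fun t => Params.energy_lower (hac := hac) (K := K) ha (F t)
  have q1 := fun t => show 0 ≤ a₀ * ‖dxL (F t)‖ ^ 2 by positivity
  have q2 := fun t => show 0 ≤ ‖zL (F t)‖ ^ 2 by positivity
  have q3 := fun t => show 0 ≤ K * p.τ * ‖uL (F t)‖ ^ 2 by positivity
  have q4 := fun t => show 0 ≤ p.m * xiL (F t) ^ 2 by positivity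
  have q5 := fun t => show 0 ≤ p.M * etaL (F t) ^ 2 by positivity
  have hdx : Tendsto (fun t => dxL (F t)) atTop (𝓝 0) := tendsto_zero_of_mul_sq_le ha₀ hV
    fun t => by linarith [hlow t, q1 t, q2 t, q3 t, q4 t, q5 t]
  have hz : Tendsto (fun t => zL (F t)) atTop (𝓝 0) := tendsto_zero_of_mul_sq_le one_pos hV
    fun t => by linarith [hlow t, q1 t, q2 t, q3 t, q4 t, q5 t]
  have hu : Tendsto (fun t => uL (F t)) atTop (𝓝 0) :=
    tendsto_zero_of_mul_sq_le (mul_pos hK hτ) hV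
      fun t => by linarith [hlow t, q1 t, q2 t, q3 t, q4 t, q5 t]
  have hξ : Tendsto (fun t => xiL (F t)) atTop (𝓝 0) := tendsto_zero_of_mul_sq_le hm hV
    fun t => by
      rw [Real.norm_eq_abs, sq_abs]; linarith [hlow t, q1 t, q2 t, q3 t, q4 t, q5 t]
  have hη : Tendsto (fun t => etaL (F t)) atTop (𝓝 0) := tendsto_zero_of_mul_sq_le hM hV
    fun t => by
      rw [Real.norm_eq_abs, sq_abs]; linarith [hlow t, q1 t, q2 t, q3 t, q4 t, q5 t]
  -- The deviation of `y` from its value at `0` tends to zero by the Poincaré inequality.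
  have hr : Tendsto (fun t => (State.y (F t)).fn - ev0 (yL (F t)) • one) atTop (𝓝 0) :=
    squeeze_zero_norm (fun t => (State.y (F t)).isWeakDeriv.norm_sub_le)
      (tendsto_zero_iff_norm_tendsto_zero.1 hdx)
  have hin : ∀ {f : ℝ → L2}, Tendsto f atTop (𝓝 0) →
      Tendsto (fun t => inner ℝ one (f t)) atTop (𝓝 0) := fun hf => by
    simpa using (tendsto_const_nhds (x := one)).inner (𝕜 := ℝ) hf
  have hev : Tendsto (fun t => ev0 (yL (F t))) atTop (𝓝 (ℓ₀ / (p.σ + p.β - p.α))) := by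
    have hlim : Tendsto (fun t => (ℓ₀ - (p.σ * inner ℝ one ((State.y (F t)).fn
        - ev0 (yL (F t)) • one) + inner ℝ one (zL (F t)) + p.α * p.τ * inner ℝ one (uL (F t))
        + p.m * xiL (F t) + p.M * etaL (F t))) / (p.σ + p.β - p.α)) atTop
        (𝓝 ((ℓ₀ - (p.σ * 0 + 0 + p.α * p.τ * 0 + p.m * 0 + p.M * 0)) / (p.σ + p.β - p.α))) :=
      (tendsto_const_nhds.sub ((((((hin hr).const_mul _).add (hin hz)).add
        ((hin hu).const_mul _)).add (hξ.const_mul _)).add (hη.const_mul _))).div_const _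
    simp only [mul_zero, add_zero, sub_zero] at hlim
    refine hlim.congr' ?_
    filter_upwards [hℓ] with t ht
    rw [Params.ellL_apply] at ht
    rw [div_eq_iff hs, ← ht, inner_sub_right, real_inner_smul_right, real_inner_self_eq_norm_sq,
      norm_one_L2]
    ring
  have hfn : Tendsto (fun t => (State.y (F t)).fn) atTop
      (𝓝 (H1.const (ℓ₀ / (p.σ + p.β - p.α))).fn) := by
    rw [fn_const]
    simpa using hr.add (hev.smul_const one)
  have hy : Tendsto (fun t => State.y (F t)) atTop
      (𝓝 (H1.const (ℓ₀ / (p.σ + p.β - p.α)))) := by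
    rw [tendsto_subtype_rng]
    exact ((WithLp.prodContinuousLinearEquiv 2 ℝ L2 L2).symm.continuous.tendsto _).comp
      (hfn.prodMk_nhds hdx)
  exact hy.prodMk_nhds (hz.prodMk_nhds (hu.prodMk_nhds (hξ.prodMk_nhds hη)))

/-! ### Mild solutions of the crane system -/

/-- A mild solution on `[0, ∞)`, extended by its initial value to negative times, is a mild solution
for the closed subspace `Params.graph`. -/
theorem Params.IsMildSolution.isMild (hac : ContinuousOn p.a (Icc 0 1)) (hτ : p.τ ≠ 0)
    (hm : p.m ≠ 0) (hM : p.M ≠ 0) {Φ₀ : State} {Φ : ℝ → State} (h : p.IsMildSolution Φ₀ Φ) :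
    IsMild (p.graph hac) (fun t => Φ (max t 0)) := by
  have hc : Continuous fun t => Φ (max t 0) :=
    h.1.comp_continuous (by fun_prop) fun t => le_max_right t 0
  have hI : ∀ t, 0 ≤ t → ∫ r in (0 : ℝ)..t, Φ (max r 0) = ∫ r in (0 : ℝ)..t, Φ r := by
    intro t ht
    refine intervalIntegral.integral_congr fun r hr => ?_
    rw [uIcc_of_le ht] at hr
    simp only [max_eq_left hr.1]
  refine ⟨hc, fun t s ht hts => ?_⟩
  have hs := ht.trans hts
  have e := (p.graph hac).sub_mem ((h.2.2 s hs).mem_graph hac hτ hm hM)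
    ((h.2.2 t ht).mem_graph hac hτ hm hM)
  rw [Prod.mk_sub_mk, sub_sub_sub_cancel_right, ← hI s hs, ← hI t ht,
    intervalIntegral.integral_interval_sub_left (hc.intervalIntegrable _ _)
      (hc.intervalIntegrable _ _)] at e
  simpa only [max_eq_left hs, max_eq_left ht] using e

end

end Crane

theorem theoremt2 (p : Crane.Params) (K : ℝ)
    (hτ : 0 < p.τ) (hm : 0 < p.m) (hM : 0 < p.M) (hσ : 0 < p.σ) (hα : p.α ≠ 0)
    (ha : Crane.MemH1 p.a) (hac : ContinuousOn p.a (Icc 0 1))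
    (ha₀ : ∃ a₀ : ℝ, 0 < a₀ ∧ ∀ x ∈ Icc (0 : ℝ) 1, a₀ ≤ p.a x)
    (hαβ : |p.α| < p.β) (hK₁ : |p.α| < K) (hK₂ : K < 2 * p.β - |p.α|)
    (y₀ : Crane.H1) (y₁ u₀ : Crane.L2) (ξ₀ η₀ : ℝ)
    (f : ℝ → ℝ) (hf : u₀ =ᵐ[Crane.mu] fun x => f (-p.τ * x))
    (Φ : ℝ → Crane.State) (hΦ : p.IsMildSolution (y₀, y₁, u₀, ξ₀, η₀) Φ)
    (ζ : ℝ)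
    (hζ : ζ = 1 / (p.σ + p.β - p.α) *
      ((∫ x in Ioo (0 : ℝ) 1, (p.σ * y₀.fn x + y₁ x + p.α * p.τ * f (-p.τ * x)))
        + (p.β - p.α) * Crane.contRep y₀.fn 0 + p.m * ξ₀ + p.M * η₀)) :
    Tendsto Φ atTop (𝓝 (Crane.equilibrium ζ)) ∧
      ∀ ϖ : ℝ, 0 < ϖ →
        Tendsto (fun t => Real.sqrt (p.innerH K ϖ
          (Φ t - Crane.equilibrium ζ) (Φ t - Crane.equilibrium ζ))) atTop (𝓝 0) := by
  obtain ⟨a₀, ha₀, hal⟩ := ha₀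
  have hs : 0 < p.σ + p.β - p.α := by linarith [le_abs_self p.α]
  have hζ' : ζ = p.ellL (y₀, y₁, u₀, ξ₀, η₀) / (p.σ + p.β - p.α) := by
    have e : ∫ x in Ioo (0 : ℝ) 1, (p.σ * y₀.fn x + y₁ x + p.α * p.τ * f (-p.τ * x))
        = ∫ x in Ioo (0 : ℝ) 1, (p.σ * y₀.fn x + y₁ x + p.α * p.τ * u₀ x) := by
      refine integral_congr_ae ?_
      filter_upwards [hf] with x hx
      rw [hx]
    rw [hζ, e, ← Crane.Params.functional_eq, Crane.Params.functional]
    ring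
  have hV := (Crane.Params.tendsto_energy_of_mild hτ hm hM hσ ha₀ hal hK₁ hK₂
    (hΦ.isMild hac hτ.ne' hm.ne' hM.ne')).congr' (f₂ := fun t => p.energy hac K (Φ t)) (by
      filter_upwards [eventually_ge_atTop 0] with t ht
      rw [max_eq_left ht])
  have hℓ : ∀ᶠ t in atTop, p.ellL (Φ t) = p.ellL (y₀, y₁, u₀, ξ₀, η₀) := by
    filter_upwards [eventually_ge_atTop 0] with t ht
    have e := Crane.Params.ellL_eq_zero ((hΦ.2.2 t ht).mem_graph hac hτ.ne' hm.ne' hM.ne')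
    rwa [map_sub, sub_eq_zero] at e
  have hlim : Tendsto Φ atTop (𝓝 (Crane.equilibrium ζ)) := by
    rw [hζ']
    exact Crane.Params.tendsto_equilibrium hτ hm hM ha₀ hal ((abs_nonneg _).trans_lt hK₁) hs.ne'
      hV hℓ
  refine ⟨hlim, fun ϖ _ => ?_⟩
  have hcont : Continuous fun Ψ : Crane.State =>
      Real.sqrt (p.energy hac K Ψ + ϖ * p.ellL Ψ * p.ellL Ψ) := by
    have := Crane.Params.continuous_energy (p := p) (hac := hac) K
    fun_prop
  have h0 := (hcont.tendsto _).comp (hlim.sub_const (Crane.equilibrium ζ))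
  rw [sub_self, Crane.Params.energy_zero, map_zero, mul_zero, add_zero, Real.sqrt_zero] at h0
  simpa only [Function.comp_def, Crane.Params.innerH_self_eq (hac := hac)] using h0
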